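/- Let $q\in\mathbb C\setminus\{0\}$ be not a root of unity. Fix a logarithm $h$ of $q$ and put $q^\alpha=e^{\alpha h}$, $[\alpha]_q=\frac{q^\alpha-q^{-\alpha}}{q-q^{-1}}$ for $\alpha\in\mathbb C$. For complex $A_1,A_2,A_3$ let $\mathrm{AW}_q(A_1,A_2,A_3)$ be the unital associative complex algebra generated by $I_1,I_2,I_3$ with the relations $$q^{1/2}I_1I_2-q^{-1/2}I_2I_1=I_3+A_3,\quad q^{1/2}I_2I_3-q^{-1/2}I_3I_2=I_1+A_1,\quad q^{1/2}I_3I_1-q^{-1/2}I_1I_3=I_2+A_2.$$ A finite-dimensional representation is called classical if none of the numbers $\frac{2\varepsilon}{q-q^{-1}}$, $\frac{\varepsilon}{q^{1/2}-q^{-1/2}}$, $\varepsilon=\pm1$, is an eigenvalue of $I_3$. For an integer $N\ge 0$ and complex numbers $\mu,j_1,j_2,j_3$ put $j_0=0$ and $$\Lambda_j=[\mu-j+1]_q+[\mu-j]_q,\quad g_j=[\mu-j+1]_q-[\mu-j]_q,\quad \tilde D_j=\frac{q(q^{1/2}-q^{-1/2})^2}{(q^{1/2}+q^{-1/2})^4}\,\frac{\prod_{k=0}^3(\Lambda_j-\Lambda_{j_k})}{g_j^2}\qquad(j\in\mathbb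 C).$$ Call $(\mu,j_1,j_2,j_3)$ admissible if $q^{2\mu}\ne-q^l$ for all $l\in\{-1,0,\dots,2N+1\}$, at least one of $\Lambda_{j_1},\Lambda_{j_2},\Lambda_{j_3}$ equals $\Lambda_{N+1}$, and none of them equals $\Lambda_k$ for any $k\in\{1,\dots,N\}$. Given $A_1,A_2$, the model is the vector space with basis $v_0,\dots,v_N$ and the operators (with $v_{-1}=v_{N+1}=0$) $$I_3v_j=-\mathrm i[\mu-j]_qv_j,$$ $$I_1v_j=\frac{-q^{-1/2}}{q^{-\mu+j}+q^{\mu-j}}(\tilde D_jv_{j-1}+v_{j+1})-\frac{A_1-\mathrm i[\mu-j]_qA_2(q^{1/2}-q^{-1/2})}{g_jg_{j+1}}v_j,$$ $$I_2v_j=\frac{\mathrm i}{q^{-\mu+j}+q^{\mu-j}}(q^{\mu-j}\tilde D_jv_{j-1}-q^{-\mu+j}v_{j+1})-\frac{-\mathrm i[\mu-j]_qA_1(q^{1/2}-q^{-1/2})+A_2}{g_jg_{j+1}}v_j.$$ Finally, define numbers $a_1,a_2,a_3$ by $$a_3=\frac{\mathrm i}{(q^{1/2}+q^{-1/2})^2}(\Lambda_0+\Lambda_{j_1}+\Lambda_{j_2}+\Lambda_{j_3}),$$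 $$\begin{aligned}a_1=\tfrac{\mathrm i}{(q^{1/2}+q^{-1/2})(q-q^{-1})}\bigl(&q^{(j_1+j_2+j_3-2\mu-1)/2}+q^{(-j_1+j_2+j_3-2\mu-1)/2}+q^{(j_1-j_2+j_3-2\mu-1)/2}+q^{(j_1+j_2-j_3-2\mu-1)/2}\\&-q^{(2\mu+1-j_1-j_2+j_3)/2}-q^{(2\mu+1-j_1-j_2-j_3)/2}-q^{(2\mu+1+j_1-j_2-j_3)/2}-q^{(2\mu+1-j_1+j_2-j_3)/2}\bigr),\end{aligned}$$ $$\begin{aligned}a_2=\tfrac{1}{(q^{1/2}+q^{-1/2})(q-q^{-1})}\bigl(&q^{-2\mu-1+(j_1+j_2+j_3)/2}-q^{(-j_1+j_2+j_3)/2}-q^{(j_1-j_2+j_3)/2}-q^{(j_1+j_2-j_3)/2}\\&-q^{-(-j_1+j_2+j_3)/2}-q^{-(j_1-j_2+j_3)/2}-q^{-(j_1+j_2-j_3)/2}+q^{2\mu+1-(j_1+j_2+j_3)/2}\bigr).\end{aligned}$$ (1) For every classical irreducible representation of $\mathrm{AW}_q(A_1,A_2,A_3)$ of dimension $N+1$,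 where $N\ge0$, there is an admissible $(\mu,j_1,j_2,j_3)$ such that $A_3=a_3$, $(A_1,A_2)\in\{(a_1,a_2),(-a_1,-a_2),(a_2,a_1),(-a_2,-a_1)\}$, and the operators of the model for $A_1,A_2$ define a representation of $\mathrm{AW}_q(A_1,A_2,A_3)$ equivalent to the given one. (2) Conversely, if $(\mu,j_1,j_2,j_3)$ is admissible, then for each pair $(A_1,A_2)$ among $(a_1,a_2),(-a_1,-a_2),(a_2,a_1),(-a_2,-a_1)$ the operators of the model define an irreducible representation of $\mathrm{AW}_q(A_1,A_2,a_3)$. -/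

import Mathlib

namespace AskeyWilson

noncomputable section

open Complex

/-! Throughout, `h` is a fixed logarithm of `q` (so `q = exp h`), and all complex powers of `q`
are taken with respect to it: `q ^ α = exp (α * h)`. -/

/-- The power `q ^ α`, where `q = exp h`. -/
def qpow (h α : ℂ) : ℂ := Complex.exp (α * h)

/-- The `q`-number `[α]_q = (q ^ α - q ^ (-α)) / (q - q⁻¹)`. -/
def qnum (h α : ℂ) : ℂ := (qpow h α - qpow h (-α)) / (qpow h 1 - qpow h (-1))

/-! ### The algebra and its representations -/

/-- The three free generators. -/
abbrev X (i : Fin 3) : FreeAlgebra ℂ (Fin 3) := FreeAlgebra.ι ℂ i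

/-- The defining relations of `AW_q(A₁, A₂, A₃)`; the generators `I₁, I₂, I₃` have the
indices `0, 1, 2`. -/
inductive Rel (h A₁ A₂ A₃ : ℂ) : FreeAlgebra ℂ (Fin 3) → FreeAlgebra ℂ (Fin 3) → Prop
  | rel₁ : Rel h A₁ A₂ A₃
      (qpow h (1 / 2) • (X 0 * X 1) - qpow h (-(1 / 2)) • (X 1 * X 0))
      (X 2 + algebraMap ℂ (FreeAlgebra ℂ (Fin 3)) A₃)
  | rel₂ : Rel h A₁ A₂ A₃
      (qpow h (1 / 2) • (X 1 * X 2) - qpow h (-(1 / 2)) • (X 2 * X 1))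
      (X 0 + algebraMap ℂ (FreeAlgebra ℂ (Fin 3)) A₁)
  | rel₃ : Rel h A₁ A₂ A₃
      (qpow h (1 / 2) • (X 2 * X 0) - qpow h (-(1 / 2)) • (X 0 * X 2))
      (X 1 + algebraMap ℂ (FreeAlgebra ℂ (Fin 3)) A₂)

/-- The Askey–Wilson algebra `AW_q(A₁, A₂, A₃)`. -/
abbrev AW (h A₁ A₂ A₃ : ℂ) : Type := RingQuot (Rel h A₁ A₂ A₃)

section Representations

variable {h A₁ A₂ A₃ : ℂ}
variable {V : Type*} [AddCommGroup V] [Module ℂ V] {W : Type*} [AddCommGroup W] [Module ℂ W]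

/-- The generator `I₁`. -/
def I₁ (h A₁ A₂ A₃ : ℂ) : AW h A₁ A₂ A₃ := RingQuot.mkAlgHom ℂ (Rel h A₁ A₂ A₃) (X 0)

/-- The generator `I₂`. -/
def I₂ (h A₁ A₂ A₃ : ℂ) : AW h A₁ A₂ A₃ := RingQuot.mkAlgHom ℂ (Rel h A₁ A₂ A₃) (X 1)

/-- The generator `I₃`. -/
def I₃ (h A₁ A₂ A₃ : ℂ) : AW h A₁ A₂ A₃ := RingQuot.mkAlgHom ℂ (Rel h A₁ A₂ A₃) (X 2)

/-- A representation is irreducible if its space is nonzero and has no nontrivial proper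
invariant subspace. -/
def IsIrreducible (ρ : AW h A₁ A₂ A₃ →ₐ[ℂ] Module.End ℂ V) : Prop :=
  Nontrivial V ∧
    ∀ U : Submodule ℂ V, (∀ a, ∀ v ∈ U, ρ a v ∈ U) → U = ⊥ ∨ U = ⊤

/-- Equivalence of representations. -/
def Equivalent (ρ : AW h A₁ A₂ A₃ →ₐ[ℂ] Module.End ℂ V)
    (σ : AW h A₁ A₂ A₃ →ₐ[ℂ] Module.End ℂ W) : Prop :=
  ∃ e : V ≃ₗ[ℂ] W, ∀ a v, e (ρ a v) = σ a (e v)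

/-- A representation is classical if neither `2ε / (q - q⁻¹)` nor
`ε / (q ^ (1/2) - q ^ (-1/2))`, `ε = ±1`, is an eigenvalue of `I₃`. -/
def IsClassical (ρ : AW h A₁ A₂ A₃ →ₐ[ℂ] Module.End ℂ V) : Prop :=
  ∀ ε : ℂ, ε = 1 ∨ ε = -1 →
    ¬ Module.End.HasEigenvalue (ρ (I₃ h A₁ A₂ A₃)) (2 * ε / (qpow h 1 - qpow h (-1))) ∧
    ¬ Module.End.HasEigenvalue (ρ (I₃ h A₁ A₂ A₃))
        (ε / (qpow h (1 / 2) - qpow h (-(1 / 2))))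

end Representations

/-! ### The explicit model -/

/-- `Λ_j = [μ - j + 1]_q + [μ - j]_q`, for complex `j`. -/
def Lam (h μ j : ℂ) : ℂ := qnum h (μ - j + 1) + qnum h (μ - j)

/-- `g_j = [μ - j + 1]_q - [μ - j]_q`. -/
def g (h μ j : ℂ) : ℂ := qnum h (μ - j + 1) - qnum h (μ - j)

/-- `D̃_j`, in factored form (with `j₀ = 0`). -/
def D (h μ j₁ j₂ j₃ j : ℂ) : ℂ :=
  qpow h 1 * (qpow h (1 / 2) - qpow h (-(1 / 2))) ^ 2 /
      (qpow h (1 / 2) + qpow h (-(1 / 2))) ^ 4 *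
    (((Lam h μ j - Lam h μ 0) * (Lam h μ j - Lam h μ j₁) *
      (Lam h μ j - Lam h μ j₂) * (Lam h μ j - Lam h μ j₃)) / g h μ j ^ 2)

/-- The tridiagonal matrix of the operator
`v_j ↦ up j • v_{j-1} + diag j • v_j + down j • v_{j+1}`, `0 ≤ j ≤ N`, `v_{-1} = v_{N+1} = 0`
(column `j` holds the image of `v_j`). -/
def tridiag (N : ℕ) (up diag down : ℕ → ℂ) : Matrix (Fin (N + 1)) (Fin (N + 1)) ℂ :=
  Matrix.of fun i j =>
    if (i : ℕ) + 1 = j then up j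
    else if i = j then diag j
    else if (i : ℕ) = j + 1 then down j
    else 0

/-- The matrix of `I₁` in the model. -/
def M₁ (h : ℂ) (N : ℕ) (A₁ A₂ μ j₁ j₂ j₃ : ℂ) : Matrix (Fin (N + 1)) (Fin (N + 1)) ℂ :=
  tridiag N
    (fun j => -qpow h (-(1 / 2)) / (qpow h (-μ + j) + qpow h (μ - j)) * D h μ j₁ j₂ j₃ j)
    (fun j => -((A₁ - I * qnum h (μ - j) * A₂ * (qpow h (1 / 2) - qpow h (-(1 / 2)))) /
      (g h μ j * g h μ (j + 1))))
    (fun j => -qpow h (-(1 / 2)) / (qpow h (-μ + j) + qpow h (μ - j)))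

/-- The matrix of `I₂` in the model. -/
def M₂ (h : ℂ) (N : ℕ) (A₁ A₂ μ j₁ j₂ j₃ : ℂ) : Matrix (Fin (N + 1)) (Fin (N + 1)) ℂ :=
  tridiag N
    (fun j => I / (qpow h (-μ + j) + qpow h (μ - j)) * (qpow h (μ - j) * D h μ j₁ j₂ j₃ j))
    (fun j => -((-I * qnum h (μ - j) * A₁ * (qpow h (1 / 2) - qpow h (-(1 / 2))) + A₂) /
      (g h μ j * g h μ (j + 1))))
    (fun j => I / (qpow h (-μ + j) + qpow h (μ - j)) * (-qpow h (-μ + j)))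

/-- The matrix of `I₃` in the model. -/
def M₃ (h : ℂ) (N : ℕ) (μ : ℂ) : Matrix (Fin (N + 1)) (Fin (N + 1)) ℂ :=
  Matrix.diagonal fun j => -I * qnum h (μ - ((j : ℕ) : ℂ))

/-- `σ` is the representation in which `I₁, I₂, I₃` act by the formulas of the model. -/
def IsModel {h A₁ A₂ A₃ : ℂ} (N : ℕ) (μ j₁ j₂ j₃ : ℂ)
    (σ : AW h A₁ A₂ A₃ →ₐ[ℂ] Module.End ℂ (Fin (N + 1) → ℂ)) : Prop :=
  σ (I₁ h A₁ A₂ A₃) = Matrix.toLin' (M₁ h N A₁ A₂ μ j₁ j₂ j₃) ∧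
  σ (I₂ h A₁ A₂ A₃) = Matrix.toLin' (M₂ h N A₁ A₂ μ j₁ j₂ j₃) ∧
  σ (I₃ h A₁ A₂ A₃) = Matrix.toLin' (M₃ h N μ)

/-- The conditions on `μ, j₁, j₂, j₃`: `q ^ (2μ) ≠ -q ^ l` for `l = -1, …, 2N + 1`; one of the
`Λ_{j_i}` equals `Λ_{N+1}`; none of them equals `Λ_k` with `1 ≤ k ≤ N`. -/
def Admissible (h : ℂ) (N : ℕ) (μ j₁ j₂ j₃ : ℂ) : Prop :=
  (∀ l : ℤ, -1 ≤ l → l ≤ 2 * N + 1 → qpow h (2 * μ) ≠ -qpow h l) ∧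
  (Lam h μ j₁ = Lam h μ (N + 1) ∨ Lam h μ j₂ = Lam h μ (N + 1) ∨
    Lam h μ j₃ = Lam h μ (N + 1)) ∧
  (∀ k : ℕ, 1 ≤ k → k ≤ N →
    Lam h μ j₁ ≠ Lam h μ k ∧ Lam h μ j₂ ≠ Lam h μ k ∧ Lam h μ j₃ ≠ Lam h μ k)

/-- The parameter `A₃` determined by `μ, j₁, j₂, j₃`. -/
def parA₃ (h μ j₁ j₂ j₃ : ℂ) : ℂ :=
  I / (qpow h (1 / 2) + qpow h (-(1 / 2))) ^ 2 *
    (Lam h μ 0 + Lam h μ j₁ + Lam h μ j₂ + Lam h μ j₃)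

/-- The parameter `A₁` determined by `μ, j₁, j₂, j₃`. -/
def parA₁ (h μ j₁ j₂ j₃ : ℂ) : ℂ :=
  I / ((qpow h (1 / 2) + qpow h (-(1 / 2))) * (qpow h 1 - qpow h (-1))) *
    (qpow h ((j₁ + j₂ + j₃ - 2 * μ - 1) / 2) + qpow h ((-j₁ + j₂ + j₃ - 2 * μ - 1) / 2)
      + qpow h ((j₁ - j₂ + j₃ - 2 * μ - 1) / 2) + qpow h ((j₁ + j₂ - j₃ - 2 * μ - 1) / 2)
      - qpow h ((2 * μ + 1 - j₁ - j₂ + j₃) / 2) - qpow h ((2 * μ + 1 - j₁ - j₂ - j₃) / 2)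
      - qpow h ((2 * μ + 1 + j₁ - j₂ - j₃) / 2) - qpow h ((2 * μ + 1 - j₁ + j₂ - j₃) / 2))

/-- The parameter `A₂` determined by `μ, j₁, j₂, j₃`. -/
def parA₂ (h μ j₁ j₂ j₃ : ℂ) : ℂ :=
  1 / ((qpow h (1 / 2) + qpow h (-(1 / 2))) * (qpow h 1 - qpow h (-1))) *
    (qpow h (-2 * μ - 1 + (j₁ + j₂ + j₃) / 2) - qpow h ((-j₁ + j₂ + j₃) / 2)
      - qpow h ((j₁ - j₂ + j₃) / 2) - qpow h ((j₁ + j₂ - j₃) / 2)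
      - qpow h (-(-j₁ + j₂ + j₃) / 2) - qpow h (-(j₁ - j₂ + j₃) / 2)
      - qpow h (-(j₁ + j₂ - j₃) / 2) + qpow h (2 * μ + 1 - (j₁ + j₂ + j₃) / 2))

/-- The four pairs `(A₁, A₂)`, `(-A₁, -A₂)`, `(A₂, A₁)`, `(-A₂, -A₁)`. -/
def parPairs (h μ j₁ j₂ j₃ : ℂ) : Set (ℂ × ℂ) :=
  {(parA₁ h μ j₁ j₂ j₃, parA₂ h μ j₁ j₂ j₃),
   (-parA₁ h μ j₁ j₂ j₃, -parA₂ h μ j₁ j₂ j₃),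
   (parA₂ h μ j₁ j₂ j₃, parA₁ h μ j₁ j₂ j₃),
   (-parA₂ h μ j₁ j₂ j₃, -parA₁ h μ j₁ j₂ j₃)}

end

end AskeyWilson

namespace AskeyWilson

noncomputable section

open Complex

/-! Write `s = q^(1/2)` and let `v` be an eigenvector of `I₃` with eigenvalue `-i[x]_q`, `t = q^x`.
The second and third relations make `I₃` act on the span of `v`, `I₁ v`, `I₂ v`. Once suitable
multiples of `v` absorb `A₁` and `A₂`, two combinations `raise` and `lower` send `v` to eigenvectors
(or zero) for `t q` and `t q⁻¹`. The excluded eigenvalues are those where the corrections are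
undefined or `raise` and `lower` become proportional. Away from them, and with `q` not a root of
unity, eigenvalues along a ladder are distinct (`lev_chain_ne`). Finite dimension then yields a
highest vector and a finite chain below it (`Relations.exists_isChain`).

The first relation makes the coefficients of raising satisfy a recursion with increment `incr`,
starting from 0. Its solution is a quartic in `Λ_j` divided by `g_j²` (`quartD_sub`): division with
remainder by the denominator matches `A₃`, `A₁A₂` and `A₁² + A₂²` with the symmetric functions of
the roots (`Match`). This explains the four pairs: the product and the sum of squares determine
`(A₁, A₂)` only up to exchange and a common sign. The start of the chain makes `Λ_0` a root, and its
end makes `Λ_{N+1}` a root. Irreducibility forbids zeros strictly between, since a zero there cuts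
off an invariant tail.

Conversely, the same computation `xy_apply` proves the first relation for the model
(`Generic.model_relations`). Distinct eigenvalues and nonzero `D̃_1, …, D̃_N` give irreducibility
(`Generic.model_irreducible`). -/

/-! ### Scalar identities in terms of `s = q ^ (1/2)` and `t = q ^ x` -/

/-- The `q`-number `[x]_q` for `q = s ^ 2` and `q ^ x = t`. -/
def qn (s t : ℂ) : ℂ := (t - t⁻¹) / (s ^ 2 - (s ^ 2)⁻¹)

/-- The eigenvalue `-i [x]_q` of `I₃`. -/
def lev (s t : ℂ) : ℂ := -I * qn s t

/-- The common denominator of the diagonal entries of `I₁` and `I₂`. -/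
def den (s t : ℂ) : ℂ := 1 + (s - s⁻¹) ^ 2 * qn s t ^ 2

/-- The negative of a diagonal entry of `I₁`. -/
def diag₁ (s A₁ A₂ t : ℂ) : ℂ := (A₁ + lev s t * (A₂ * (s - s⁻¹))) / den s t

/-- The negative of a diagonal entry of `I₂`. -/
def diag₂ (s A₁ A₂ t : ℂ) : ℂ := (A₂ + lev s t * (A₁ * (s - s⁻¹))) / den s t

/-- `t = q ^ x` is regular if `-i [x]_q` is none of the excluded eigenvalues. -/
structure Reg (s t : ℂ) : Prop where
  ne : t ≠ 0
  mid : t ^ 2 + 1 ≠ 0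
  up : t ^ 2 * s ^ 2 + 1 ≠ 0
  down : t ^ 2 + s ^ 2 ≠ 0

section Scalars

variable {s t : ℂ}

theorem sq_sub_one_ne (h4 : s ^ 4 ≠ 1) : s ^ 2 - 1 ≠ 0 := fun h => h4 (by
  linear_combination (s ^ 2 + 1) * h)

theorem sq_add_one_ne (h4 : s ^ 4 ≠ 1) : s ^ 2 + 1 ≠ 0 := fun h => h4 (by
  linear_combination (s ^ 2 - 1) * h)

theorem qn_eq (hs : s ≠ 0) (h4 : s ^ 4 ≠ 1) (ht : t ≠ 0) :
    qn s t = s ^ 2 * (t ^ 2 - 1) / (t * ((s ^ 2 - 1) * (s ^ 2 + 1))) := by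
  have h1 := sq_sub_one_ne h4
  have h2 := sq_add_one_ne h4
  have h3 : s ^ 2 - (s ^ 2)⁻¹ = (s ^ 2 - 1) * (s ^ 2 + 1) / s ^ 2 := by field_simp; ring
  rw [qn, h3]
  field_simp

theorem den_eq (hs : s ≠ 0) (h4 : s ^ 4 ≠ 1) (ht : t ≠ 0) :
    den s t = (t ^ 2 * s ^ 2 + 1) * (t ^ 2 + s ^ 2) / (t ^ 2 * (s ^ 2 + 1) ^ 2) := by
  have h1 := sq_sub_one_ne h4
  have h2 := sq_add_one_ne h4
  rw [den, qn_eq hs h4 ht]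
  field_simp
  ring

theorem Reg.den_ne (hs : s ≠ 0) (h4 : s ^ 4 ≠ 1) (r : Reg s t) : den s t ≠ 0 := by
  rw [den_eq hs h4 r.ne]
  exact div_ne_zero (mul_ne_zero r.up r.down)
    (mul_ne_zero (pow_ne_zero _ r.ne) (pow_ne_zero _ (sq_add_one_ne h4)))

/-- `diag₁` and `diag₂` are the Cramer solution of a 2 × 2 linear system with determinant `den s t`,
which is `1 - (s - s⁻¹)² · lev²`. This system is what removes the `v`-term in `Relations.Z_raise`
and `Relations.Z_lower`. -/
theorem diag₁_eq (A₁ A₂ : ℂ) (hd : den s t ≠ 0) :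
    diag₁ s A₁ A₂ t = A₁ + lev s t * (s - s⁻¹) * diag₂ s A₁ A₂ t := by
  have : lev s t ^ 2 * (s - s⁻¹) ^ 2 = 1 - den s t := by
    rw [lev, den]; ring_nf; rw [I_sq]; ring
  rw [diag₁, diag₂, div_eq_iff hd, add_mul, mul_assoc, div_mul_cancel₀ _ hd]
  linear_combination -A₁ * this

theorem diag₂_eq (A₁ A₂ : ℂ) (hd : den s t ≠ 0) :
    diag₂ s A₁ A₂ t = A₂ + lev s t * (s - s⁻¹) * diag₁ s A₁ A₂ t :=
  diag₁_eq A₂ A₁ hd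

/-- Two adjacent diagonal entries: the identity for the lowering part. -/
theorem diag_lower (hs : s ≠ 0) (h4 : s ^ 4 ≠ 1) (A₁ A₂ : ℂ) (r : Reg s t)
    (r' : Reg s (t / s ^ 2)) :
    I * s / t * diag₁ s A₁ A₂ (t / s ^ 2) - (s ^ 2)⁻¹ * diag₂ s A₁ A₂ (t / s ^ 2)
      + diag₂ s A₁ A₂ t - I * s⁻¹ / t * diag₁ s A₁ A₂ t = 0 := by
  have h1 := sq_sub_one_ne h4
  have h2 := sq_add_one_ne h4
  have h3 := r.ne
  have h5 := r.up
  have h5' : s ^ 2 * t ^ 2 + 1 ≠ 0 := by rw [mul_comm]; exact r.up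
  have h6 := r.down
  have h7 : t ^ 2 + s ^ 6 ≠ 0 := fun h => r'.down (by field_simp; linear_combination h)
  simp only [diag₁, diag₂, lev, den_eq hs h4 r.ne, den_eq hs h4 r'.ne, qn_eq hs h4 r.ne,
    qn_eq hs h4 r'.ne]
  have e1 : (t / s ^ 2) ^ 2 * s ^ 2 + 1 = (t ^ 2 + s ^ 2) / s ^ 2 := by field_simp
  have e2 : (t / s ^ 2) ^ 2 + s ^ 2 = (t ^ 2 + s ^ 6) / s ^ 4 := by field_simp
  rw [e1, e2]
  field_simp
  ring_nf
  simp only [I_sq]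
  ring

/-- Two adjacent diagonal entries: the identity for the raising part. -/
theorem diag_raise (hs : s ≠ 0) (h4 : s ^ 4 ≠ 1) (A₁ A₂ : ℂ) (r : Reg s t)
    (r' : Reg s (t * s ^ 2)) :
    -I * s * t * diag₁ s A₁ A₂ (t * s ^ 2) - (s ^ 2)⁻¹ * diag₂ s A₁ A₂ (t * s ^ 2)
      + diag₂ s A₁ A₂ t + I * s⁻¹ * t * diag₁ s A₁ A₂ t = 0 := by
  have h1 := sq_sub_one_ne h4
  have h2 := sq_add_one_ne h4
  have h3 := r.ne
  have h5 := r.up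
  have h5' : s ^ 2 * t ^ 2 + 1 ≠ 0 := by rw [mul_comm]; exact r.up
  have h6 := r.down
  have h7 : t ^ 2 * s ^ 6 + 1 ≠ 0 := fun h => r'.up (by linear_combination h)
  have h7' : s ^ 6 * t ^ 2 + 1 ≠ 0 := by rw [mul_comm]; exact h7
  simp only [diag₁, diag₂, lev, den_eq hs h4 r.ne, den_eq hs h4 r'.ne, qn_eq hs h4 r.ne,
    qn_eq hs h4 r'.ne]
  have e1 : (t * s ^ 2) ^ 2 * s ^ 2 + 1 = t ^ 2 * s ^ 6 + 1 := by ring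
  have e2 : (t * s ^ 2) ^ 2 + s ^ 2 = (t ^ 2 * s ^ 2 + 1) * s ^ 2 := by ring
  rw [e1, e2]
  field_simp
  ring_nf
  simp only [I_sq]
  ring

theorem lev_up (hs : s ≠ 0) (h4 : s ^ 4 ≠ 1) (ht : t ≠ 0) :
    lev s (t * s ^ 2) = s ^ 2 * lev s t - I * (t⁻¹) := by
  have h1 := sq_sub_one_ne h4
  have h2 := sq_add_one_ne h4
  rw [lev, lev, qn_eq hs h4 ht, qn_eq hs h4 (by positivity)]
  field_simp
  ring

theorem lev_up' (hs : s ≠ 0) (h4 : s ^ 4 ≠ 1) (ht : t ≠ 0) :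
    lev s (t * s ^ 2) = (s ^ 2)⁻¹ * lev s t - I * t := by
  have h1 := sq_sub_one_ne h4
  have h2 := sq_add_one_ne h4
  rw [lev, lev, qn_eq hs h4 ht, qn_eq hs h4 (by positivity)]
  field_simp
  ring

theorem lev_down (hs : s ≠ 0) (h4 : s ^ 4 ≠ 1) (ht : t ≠ 0) :
    lev s (t / s ^ 2) = s ^ 2 * lev s t + I * t := by
  have h1 := sq_sub_one_ne h4
  have h2 := sq_add_one_ne h4
  rw [lev, lev, qn_eq hs h4 ht, qn_eq hs h4 (by positivity)]
  field_simp
  ring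

theorem lev_down' (hs : s ≠ 0) (h4 : s ^ 4 ≠ 1) (ht : t ≠ 0) :
    lev s (t / s ^ 2) = (s ^ 2)⁻¹ * lev s t + I * t⁻¹ := by
  have h1 := sq_sub_one_ne h4
  have h2 := sq_add_one_ne h4
  rw [lev, lev, qn_eq hs h4 ht, qn_eq hs h4 (by positivity)]
  field_simp
  ring

/-- The level depends on `t` only through `t - t⁻¹`, whose fibres are `{t, -t⁻¹}`. -/
theorem lev_inj (h4 : s ^ 4 ≠ 1) (hs : s ≠ 0) {t' : ℂ} (ht : t ≠ 0) (ht' : t' ≠ 0)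
    (h : lev s t = lev s t') : t = t' ∨ t * t' = -1 := by
  have h1 := sq_sub_one_ne h4
  have h2 := sq_add_one_ne h4
  rw [lev, lev, qn_eq hs h4 ht, qn_eq hs h4 ht'] at h
  have h' := mul_left_cancel₀ (neg_ne_zero.2 I_ne_zero) h
  field_simp at h'
  have : (t - t') * (t * t' + 1) = 0 := by linear_combination h'
  rcases mul_eq_zero.1 this with h | h
  · exact Or.inl (sub_eq_zero.1 h)
  · exact Or.inr (eq_neg_of_add_eq_zero_left h)

/-- The increment of the coefficients `D̃_j`. -/
def incr (s A₁ A₂ A₃ t : ℂ) : ℂ :=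
  -I * s ^ 2 * (t + t⁻¹) *
    (lev s t + A₃ - (s - s⁻¹) * (diag₁ s A₁ A₂ t * diag₂ s A₁ A₂ t))

/-- `D̃` as a function of `y = q ^ (x + 1/2)`, for the quartic with elementary symmetric
functions `e₁, …, e₄` of its roots. -/
def quartD (s e₁ e₂ e₃ e₄ y : ℂ) : ℂ :=
  s ^ 2 / (s + s⁻¹) ^ 2 * ((((y - y⁻¹) / (s - s⁻¹)) ^ 4 - e₁ * ((y - y⁻¹) / (s - s⁻¹)) ^ 3
    + e₂ * ((y - y⁻¹) / (s - s⁻¹)) ^ 2 - e₃ * ((y - y⁻¹) / (s - s⁻¹)) + e₄) /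
    ((y + y⁻¹) / (s - s⁻¹)) ^ 2)

end Scalars

/-! ### Closed form of the recursion for the raising coefficients -/

section Quartic

theorem quartic_div {c e₁ e₂ e₃ e₄ x : ℂ} (hx : x ^ 2 + c ≠ 0) :
    (x ^ 4 - e₁ * x ^ 3 + e₂ * x ^ 2 - e₃ * x + e₄) / (x ^ 2 + c) =
      x ^ 2 - e₁ * x + (e₂ - c) + ((c * e₁ - e₃) * x + (e₄ - c * e₂ + c ^ 2)) / (x ^ 2 + c) := by
  field_simp
  ring

/-- Here `x`, `x'` stand for `Λ_j`, `Λ_{j+1}`, with `w = s - s⁻¹`, `k = s + s⁻¹`, `n = [μ - j]_q`,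
`T = t + t⁻¹`. The two denominators multiply to a constant times `den²`, the denominator of `diag₁ *
diag₂`. -/
theorem linear_div_sub {a b w k n x x' T : ℂ} (hw : w ≠ 0)
    (hk : k ^ 2 = w ^ 2 + 4) (hsub : x' - x = -T) (hadd : x' + x = k ^ 2 * n)
    (hT : T ^ 2 = k ^ 2 * w ^ 2 * n ^ 2 + 4) (hx : x ^ 2 + 4 / w ^ 2 ≠ 0)
    (hx' : x' ^ 2 + 4 / w ^ 2 ≠ 0)
    (hd : (x ^ 2 + 4 / w ^ 2) * (x' ^ 2 + 4 / w ^ 2) = k ^ 4 * (1 + w ^ 2 * n ^ 2) ^ 2 / w ^ 4) :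
    (a * x' + b) / (x' ^ 2 + 4 / w ^ 2) - (a * x + b) / (x ^ 2 + 4 / w ^ 2) =
      T * k ^ 2 * (b * n - a / w ^ 2 * (1 - w ^ 2 * n ^ 2)) * w ^ 4 /
        (k ^ 4 * (1 + w ^ 2 * n ^ 2) ^ 2) := by
  have hne := mul_ne_zero hx hx'
  -- From `4xx' = (x' + x)² - (x' - x)²`.
  have hxx : x * x' = k ^ 2 * n ^ 2 - 1 := by
    have : 4 * (x * x') = 4 * (k ^ 2 * n ^ 2 - 1) := by
      linear_combination (x' + x + k ^ 2 * n) * hadd - (x' - x - T) * hsub - hT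
        + k ^ 2 * n ^ 2 * hk
    exact mul_left_cancel₀ (by norm_num) this
  have e : (a * x' + b) / (x' ^ 2 + 4 / w ^ 2) - (a * x + b) / (x ^ 2 + 4 / w ^ 2) =
      T * k ^ 2 * (b * n - a / w ^ 2 * (1 - w ^ 2 * n ^ 2)) /
        ((x ^ 2 + 4 / w ^ 2) * (x' ^ 2 + 4 / w ^ 2)) := by
    rw [div_sub_div _ _ hx' hx, mul_comm (x ^ 2 + 4 / w ^ 2) (x' ^ 2 + 4 / w ^ 2)]
    congr 1
    have hT' : T = x - x' := by linear_combination hsub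
    have hc : (4 : ℂ) / w ^ 2 = (k ^ 2) / w ^ 2 - 1 := by
      rw [hk]; field_simp; ring
    rw [hT', hc]
    linear_combination (x - x') * a * hxx + (x - x') * b * hadd - (x - x') * a * n ^ 2 * k ^ 2 * (mul_inv_cancel₀ (pow_ne_zero 2 hw))
  rw [e, hd, div_div_eq_mul_div]

/-- The polynomial quotients in `quartic_div` produce `lev s t + A₃`, and the linear remainders
produce the product of the diagonal entries. The three hypotheses are the resulting comparison of
coefficients. -/
theorem quartD_sub {s t e₁ e₂ e₃ e₄ A₁ A₂ A₃ : ℂ} (hs : s ≠ 0) (h4 : s ^ 4 ≠ 1) (r : Reg s t)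
    (h₃ : A₃ = I * e₁ / (s + s⁻¹) ^ 2)
    (hp : A₁ * A₂ = I * (s - s⁻¹) * (4 / (s - s⁻¹) ^ 2 * e₁ - e₃) / (s + s⁻¹) ^ 4)
    (hq : A₁ ^ 2 + A₂ ^ 2 = (s - s⁻¹) ^ 2 *
      (e₄ - 4 / (s - s⁻¹) ^ 2 * e₂ + (4 / (s - s⁻¹) ^ 2) ^ 2) / (s + s⁻¹) ^ 4) :
    quartD s e₁ e₂ e₃ e₄ (t / s) - quartD s e₁ e₂ e₃ e₄ (t * s) = incr s A₁ A₂ A₃ t := by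
  have h1 := sq_sub_one_ne h4
  have h2 := sq_add_one_ne h4
  have ht := r.ne
  have hw : s - s⁻¹ ≠ 0 := by
    have : s - s⁻¹ = (s ^ 2 - 1) / s := by field_simp
    rw [this]; exact div_ne_zero h1 hs
  have hk0 : s + s⁻¹ ≠ 0 := by
    have : s + s⁻¹ = (s ^ 2 + 1) / s := by field_simp
    rw [this]; exact div_ne_zero h2 hs
  have hden : 1 + (s - s⁻¹) ^ 2 * qn s t ^ 2 ≠ 0 := r.den_ne hs h4
  have hn : qn s t = (t - t⁻¹) / ((s - s⁻¹) * (s + s⁻¹)) := by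
    rw [qn]; congr 1; field_simp; ring
  have hk : (s + s⁻¹) ^ 2 = (s - s⁻¹) ^ 2 + 4 := by field_simp; ring
  have hss : s * s⁻¹ = 1 := mul_inv_cancel₀ hs
  have htt : t * t⁻¹ = 1 := mul_inv_cancel₀ ht
  set k := s + s⁻¹ with hkdef
  set w := s - s⁻¹ with hwdef
  set n := qn s t with hndef
  have hn' : t - t⁻¹ = n * (w * k) := by rw [hn]; field_simp
  obtain ⟨x, hx⟩ : ∃ x, x = (t * s - (t * s)⁻¹) / w := ⟨_, rfl⟩
  obtain ⟨x', hx'⟩ : ∃ x', x' = (t / s - (t / s)⁻¹) / w := ⟨_, rfl⟩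
  obtain ⟨T, hTd⟩ : ∃ T, T = t + t⁻¹ := ⟨_, rfl⟩
  have hG : ((t * s + (t * s)⁻¹) / w) ^ 2 = x ^ 2 + 4 / w ^ 2 := by
    rw [hx]; field_simp; ring
  have hG' : ((t / s + (t / s)⁻¹) / w) ^ 2 = x' ^ 2 + 4 / w ^ 2 := by
    rw [hx']; field_simp; ring
  have hGG : (x ^ 2 + 4 / w ^ 2) * (x' ^ 2 + 4 / w ^ 2) =
      k ^ 4 * (1 + w ^ 2 * n ^ 2) ^ 2 / w ^ 4 := by
    have e := den_eq hs h4 ht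
    rw [den, ← hndef, ← hwdef] at e
    rw [← hG, ← hG', e, hkdef]
    field_simp
  have hne : (x ^ 2 + 4 / w ^ 2) * (x' ^ 2 + 4 / w ^ 2) ≠ 0 := by
    rw [hGG]
    exact div_ne_zero (mul_ne_zero (pow_ne_zero _ hk0) (pow_ne_zero _ hden)) (pow_ne_zero _ hw)
  have hsub : x' - x = -T := by
    rw [hx, hx', hTd, ← sub_div, div_eq_iff hw, hwdef]
    field_simp
    ring
  have hadd : x' + x = k ^ 2 * n := by
    rw [hx, hx', hn, ← add_div]
    field_simp
    rw [hkdef]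
    field_simp
    ring
  have hT : T ^ 2 = k ^ 2 * w ^ 2 * n ^ 2 + 4 := by
    rw [hTd]
    linear_combination (t - t⁻¹ + n * (w * k)) * hn' + 4 * htt
  have hL := linear_div_sub (a := 4 / w ^ 2 * e₁ - e₃)
    (b := e₄ - 4 / w ^ 2 * e₂ + (4 / w ^ 2) ^ 2) hw hk hsub hadd hT (left_ne_zero_of_mul hne)
    (right_ne_zero_of_mul hne) hGG
  have hb : diag₁ s A₁ A₂ t * diag₂ s A₁ A₂ t =
      (A₁ * A₂ * (1 - w ^ 2 * n ^ 2) - I * n * w * (A₁ ^ 2 + A₂ ^ 2)) /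
        (1 + w ^ 2 * n ^ 2) ^ 2 := by
    rw [diag₁, diag₂, den, lev, ← hndef, ← hwdef, div_mul_div_comm, ← sq]
    congr 1
    linear_combination n ^ 2 * w ^ 2 * A₁ * A₂ * I_sq
  rw [quartD, quartD, incr, ← hkdef, ← hwdef, ← hx, ← hx', hG, hG', ← mul_sub,
    quartic_div (left_ne_zero_of_mul hne), quartic_div (right_ne_zero_of_mul hne), hb, hp, hq,
    ← hTd, h₃, lev, ← hndef]
  obtain ⟨R, hR⟩ : ∃ R, R = ((4 / w ^ 2 * e₁ - e₃) * x' +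
    (e₄ - 4 / w ^ 2 * e₂ + (4 / w ^ 2) ^ 2)) / (x' ^ 2 + 4 / w ^ 2) -
    ((4 / w ^ 2 * e₁ - e₃) * x + (e₄ - 4 / w ^ 2 * e₂ + (4 / w ^ 2) ^ 2)) /
      (x ^ 2 + 4 / w ^ 2) := ⟨_, rfl⟩
  rw [← hR] at hL
  have hx2 : x' ^ 2 - x ^ 2 = -T * (k ^ 2 * n) := by rw [← hadd, ← hsub]; ring
  have hlhs : s ^ 2 / k ^ 2 * (x' ^ 2 - e₁ * x' + (e₂ - 4 / w ^ 2) + ((4 / w ^ 2 * e₁ - e₃) * x' +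
    (e₄ - 4 / w ^ 2 * e₂ + (4 / w ^ 2) ^ 2)) / (x' ^ 2 + 4 / w ^ 2) - (x ^ 2 - e₁ * x
    + (e₂ - 4 / w ^ 2) + ((4 / w ^ 2 * e₁ - e₃) * x + (e₄ - 4 / w ^ 2 * e₂ + (4 / w ^ 2) ^ 2)) /
      (x ^ 2 + 4 / w ^ 2))) = s ^ 2 / k ^ 2 * (-T * (k ^ 2 * n) + e₁ * T + R) := by
    rw [hR]; linear_combination s ^ 2 / k ^ 2 * (hx2 - e₁ * hsub)
  rw [hlhs, hL]
  clear_value k w n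
  field_simp
  ring_nf
  simp only [I_sq]
  ring

end Quartic

/-! ### Identities behind the formulas for `A₁` and `A₂` -/

section Parameters

/-- Numerator of the parameter `A₁`, with `z_k = q ^ ((μ + 1/2 - j_k)/2)`. -/
def S₁ (z₀ z₁ z₂ z₃ : ℂ) : ℂ :=
  z₀ / (z₁ * z₂ * z₃) + z₁ / (z₀ * z₂ * z₃) + z₂ / (z₀ * z₁ * z₃) + z₃ / (z₀ * z₁ * z₂)
  - z₀ * z₁ * z₂ / z₃ - z₁ * z₂ * z₃ / z₀ - z₀ * z₂ * z₃ / z₁ - z₀ * z₁ * z₃ / z₂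

/-- Numerator of the parameter `A₂`. -/
def S₂ (z₀ z₁ z₂ z₃ : ℂ) : ℂ :=
  z₀ * z₁ * z₂ * z₃ + 1 / (z₀ * z₁ * z₂ * z₃)
  - z₀ * z₁ / (z₂ * z₃) - z₀ * z₂ / (z₁ * z₃) - z₀ * z₃ / (z₁ * z₂)
  - z₂ * z₃ / (z₀ * z₁) - z₁ * z₃ / (z₀ * z₂) - z₁ * z₂ / (z₀ * z₃)

variable {z₀ z₁ z₂ z₃ : ℂ}

/-- The `l_k` are the `Λ_{j_k}` scaled by `s - s⁻¹`. `S₁` and `S₂` need square roots of `q^(μ + 1/2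
- j_k)`, but this product and the difference of squares below are symmetric polynomials in the
`Λ_{j_k}`, as `Match` requires. -/
theorem S₁_mul_S₂ (h₀ : z₀ ≠ 0) (h₁ : z₁ ≠ 0) (h₂ : z₂ ≠ 0) (h₃ : z₃ ≠ 0) {l₀ l₁ l₂ l₃ : ℂ}
    (k₀ : l₀ = z₀ ^ 2 - (z₀ ^ 2)⁻¹) (k₁ : l₁ = z₁ ^ 2 - (z₁ ^ 2)⁻¹)
    (k₂ : l₂ = z₂ ^ 2 - (z₂ ^ 2)⁻¹) (k₃ : l₃ = z₃ ^ 2 - (z₃ ^ 2)⁻¹) :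
    S₁ z₀ z₁ z₂ z₃ * S₂ z₀ z₁ z₂ z₃ =
      4 * (l₀ + l₁ + l₂ + l₃)
        - (l₀ * l₁ * l₂ + l₀ * l₁ * l₃ + l₀ * l₂ * l₃ + l₁ * l₂ * l₃) := by
  rw [k₀, k₁, k₂, k₃, S₁, S₂]
  field_simp
  ring

theorem S₂_sq_sub_S₁_sq (h₀ : z₀ ≠ 0) (h₁ : z₁ ≠ 0) (h₂ : z₂ ≠ 0) (h₃ : z₃ ≠ 0)
    {l₀ l₁ l₂ l₃ : ℂ}
    (k₀ : l₀ = z₀ ^ 2 - (z₀ ^ 2)⁻¹) (k₁ : l₁ = z₁ ^ 2 - (z₁ ^ 2)⁻¹)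
    (k₂ : l₂ = z₂ ^ 2 - (z₂ ^ 2)⁻¹) (k₃ : l₃ = z₃ ^ 2 - (z₃ ^ 2)⁻¹) :
    S₂ z₀ z₁ z₂ z₃ ^ 2 - S₁ z₀ z₁ z₂ z₃ ^ 2 =
      l₀ * l₁ * l₂ * l₃
        - 4 * (l₀ * l₁ + l₀ * l₂ + l₀ * l₃ + l₁ * l₂ + l₁ * l₃ + l₂ * l₃) + 16 := by
  rw [k₀, k₁, k₂, k₃, S₁, S₂]
  field_simp
  ring

/-- Both `(A + B)²` and `(A - B)²` are known; the four sign choices give the four pairs. -/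
theorem eq_or_of_mul_eq_of_sq_add_sq_eq {A B a b : ℂ} (hm : A * B = a * b)
    (hs : A ^ 2 + B ^ 2 = a ^ 2 + b ^ 2) :
    (A = a ∧ B = b) ∨ (A = -a ∧ B = -b) ∨ (A = b ∧ B = a) ∨ (A = -b ∧ B = -a) := by
  have h1 : (A + B) ^ 2 = (a + b) ^ 2 := by linear_combination hs + 2 * hm
  have h2 : (A - B) ^ 2 = (a - b) ^ 2 := by linear_combination hs - 2 * hm
  rcases sq_eq_sq_iff_eq_or_eq_neg.1 h1 with h1 | h1 <;>
  rcases sq_eq_sq_iff_eq_or_eq_neg.1 h2 with h2 | h2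
  · exact Or.inl ⟨by linear_combination (h1 + h2) / 2, by linear_combination (h1 - h2) / 2⟩
  · exact Or.inr (Or.inr (Or.inl ⟨by linear_combination (h1 + h2) / 2,
      by linear_combination (h1 - h2) / 2⟩))
  · exact Or.inr (Or.inr (Or.inr ⟨by linear_combination (h1 + h2) / 2,
      by linear_combination (h1 - h2) / 2⟩))
  · exact Or.inr (Or.inl ⟨by linear_combination (h1 + h2) / 2,
      by linear_combination (h1 - h2) / 2⟩)

end Parameters

/-! ### Raising and lowering operators -/

section Ladder

variable {V : Type*} [AddCommGroup V] [Module ℂ V]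

/-- The defining relations, for three operators. -/
structure Relations (s A₁ A₂ A₃ : ℂ) (X Y Z : Module.End ℂ V) : Prop where
  xy : ∀ v, s • X (Y v) - s⁻¹ • Y (X v) = Z v + A₃ • v
  yz : ∀ v, s • Y (Z v) - s⁻¹ • Z (Y v) = X v + A₁ • v
  zx : ∀ v, s • Z (X v) - s⁻¹ • X (Z v) = Y v + A₂ • v

/-- The raised vector (for an eigenvector `v` of eigenvalue `-i [x]_q`, `t = q ^ x`). -/
def raise (s A₁ A₂ t : ℂ) (X Y : Module.End ℂ V) : Module.End ℂ V :=
  -((s / t) • (X + diag₁ s A₁ A₂ t • 1) + I • (Y + diag₂ s A₁ A₂ t • 1))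

/-- The lowered vector. -/
def lower (s A₁ A₂ t : ℂ) (X Y : Module.End ℂ V) : Module.End ℂ V :=
  -((s * t) • (X + diag₁ s A₁ A₂ t • 1) - I • (Y + diag₂ s A₁ A₂ t • 1))

variable {s t A₁ A₂ A₃ : ℂ} {X Y Z : Module.End ℂ V}

theorem raise_apply (v : V) : raise s A₁ A₂ t X Y v =
    -((s / t) • (X v + diag₁ s A₁ A₂ t • v) + I • (Y v + diag₂ s A₁ A₂ t • v)) := by
  simp [raise]

theorem lower_apply (v : V) : lower s A₁ A₂ t X Y v =
    -((s * t) • (X v + diag₁ s A₁ A₂ t • v) - I • (Y v + diag₂ s A₁ A₂ t • v)) := by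
  simp [lower]

/-- `raise` and `lower` are combinations of the corrected `X` and `Y` whose determinant is a
multiple of `t + t⁻¹`, so they can be inverted unless `t² = -1`. -/
theorem X_eq (hs : s ≠ 0) (ht : t ≠ 0) (hT : t ^ 2 + 1 ≠ 0) (v : V) :
    X v = (-s⁻¹ / (t + t⁻¹)) • (raise s A₁ A₂ t X Y v + lower s A₁ A₂ t X Y v)
      - diag₁ s A₁ A₂ t • v := by
  have hT' : t + t⁻¹ = (t ^ 2 + 1) / t := by field_simp
  rw [raise_apply, lower_apply, hT']
  match_scalars <;> field_simp <;> ring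

theorem Y_eq (ht : t ≠ 0) (hT : t ^ 2 + 1 ≠ 0) (v : V) :
    Y v = (I / (t + t⁻¹)) • (t • raise s A₁ A₂ t X Y v - t⁻¹ • lower s A₁ A₂ t X Y v)
      - diag₂ s A₁ A₂ t • v := by
  have hT' : t + t⁻¹ = (t ^ 2 + 1) / t := by field_simp
  rw [raise_apply, lower_apply, hT']
  match_scalars <;> field_simp <;> ring_nf <;> simp only [I_sq] <;> ring

theorem Relations.Z_Y (R : Relations s A₁ A₂ A₃ X Y Z) (hs : s ≠ 0) {c : ℂ} {v : V}
    (hv : Z v = c • v) : Z (Y v) = (s ^ 2 * c) • Y v - s • (X v + A₁ • v) := by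
  have h := R.yz v
  rw [hv, map_smul] at h
  rw [← h]
  match_scalars <;> field_simp <;> ring

theorem Relations.Z_X (R : Relations s A₁ A₂ A₃ X Y Z) (hs : s ≠ 0) {c : ℂ} {v : V}
    (hv : Z v = c • v) : Z (X v) = ((s ^ 2)⁻¹ * c) • X v + s⁻¹ • (Y v + A₂ • v) := by
  have h := R.zx v
  rw [hv, map_smul] at h
  rw [← h]
  match_scalars <;> field_simp <;> ring

/-- In the basis `X v`, `Y v`, `v`, the two forms `lev_up'` and `lev_up` of the new eigenvalue
settle the first two coefficients, and the linear system for the diagonal entries settles the third.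
-/
theorem Relations.Z_raise (R : Relations s A₁ A₂ A₃ X Y Z) (hs : s ≠ 0) (h4 : s ^ 4 ≠ 1)
    (r : Reg s t) {v : V} (hv : Z v = lev s t • v) :
    Z (raise s A₁ A₂ t X Y v) = lev s (t * s ^ 2) • raise s A₁ A₂ t X Y v := by
  have h1 := diag₁_eq A₁ A₂ (r.den_ne hs h4)
  have h2 := diag₂_eq A₁ A₂ (r.den_ne hs h4)
  have e1 := lev_up hs h4 r.ne
  have e2 := lev_up' hs h4 r.ne
  have ht := r.ne
  rw [raise_apply, map_neg, map_add, map_smul, map_smul, map_add, map_add, map_smul, map_smul,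
    R.Z_Y hs hv, R.Z_X hs hv, hv]
  generalize diag₁ s A₁ A₂ t = b₁ at *
  generalize diag₂ s A₁ A₂ t = b₂ at *
  generalize lev s t = c at *
  generalize lev s (t * s ^ 2) = E at *
  obtain rfl : A₁ = b₁ - c * (s - s⁻¹) * b₂ := by linear_combination -h1
  obtain rfl : A₂ = b₂ - c * (s - s⁻¹) * b₁ := by linear_combination -h2
  match_scalars
  · linear_combination (norm := (field_simp; ring)) (s / t) * e2
  · linear_combination (norm := (field_simp; ring_nf; simp only [I_sq]; ring)) I * e1
  · linear_combination (norm := (field_simp; ring_nf; simp only [I_sq]; ring))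
      (s / t) * b₁ * e2 + I * b₂ * e1

theorem Relations.Z_lower (R : Relations s A₁ A₂ A₃ X Y Z) (hs : s ≠ 0) (h4 : s ^ 4 ≠ 1)
    (r : Reg s t) {v : V} (hv : Z v = lev s t • v) :
    Z (lower s A₁ A₂ t X Y v) = lev s (t / s ^ 2) • lower s A₁ A₂ t X Y v := by
  have h1 := diag₁_eq A₁ A₂ (r.den_ne hs h4)
  have h2 := diag₂_eq A₁ A₂ (r.den_ne hs h4)
  have e1 := lev_down hs h4 r.ne
  have e2 := lev_down' hs h4 r.ne
  have ht := r.ne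
  rw [lower_apply, map_neg, map_sub, map_smul, map_smul, map_add, map_add, map_smul, map_smul,
    R.Z_Y hs hv, R.Z_X hs hv, hv]
  generalize diag₁ s A₁ A₂ t = b₁ at *
  generalize diag₂ s A₁ A₂ t = b₂ at *
  generalize lev s t = c at *
  generalize lev s (t / s ^ 2) = E at *
  obtain rfl : A₁ = b₁ - c * (s - s⁻¹) * b₂ := by linear_combination -h1
  obtain rfl : A₂ = b₂ - c * (s - s⁻¹) * b₁ := by linear_combination -h2
  match_scalars
  · linear_combination (norm := (field_simp; ring)) (s * t) * e2
  · linear_combination (norm := (field_simp; ring_nf; simp only [I_sq]; ring)) -I * e1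
  · linear_combination (norm := (field_simp; ring_nf; simp only [I_sq]; ring))
      (s * t) * b₁ * e2 - I * b₂ * e1

/-- The first relation on an eigenvector `v` with raised vector `d • p` and lowered vector `w`. -/
theorem xy_apply (hs : s ≠ 0) (h4 : s ^ 4 ≠ 1) (r : Reg s t) {v p w : V} {d : ℂ}
    (hX : X v = (-s⁻¹ / (t + t⁻¹)) • (d • p + w) - diag₁ s A₁ A₂ t • v)
    (hY : Y v = (I / (t + t⁻¹)) • (t • d • p - t⁻¹ • w) - diag₂ s A₁ A₂ t • v)
    (hp : d = 0 ∨ Reg s (t * s ^ 2) ∧ lower s A₁ A₂ (t * s ^ 2) X Y p = v)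
    (hw : w = 0 ∨ Reg s (t / s ^ 2)) :
    s • X (Y v) - s⁻¹ • Y (X v) =
      (I / (s ^ 2 * (t + t⁻¹))) • (raise s A₁ A₂ (t / s ^ 2) X Y w - d • v)
        + ((s - s⁻¹) * (diag₁ s A₁ A₂ t * diag₂ s A₁ A₂ t)) • v := by
  have ht := r.ne
  have hT : t + t⁻¹ ≠ 0 := by
    have : t + t⁻¹ = (t ^ 2 + 1) / t := by field_simp
    rw [this]
    exact div_ne_zero r.mid ht
  -- All terms containing `w`. By `diag_lower` the diagonal entries at `t` may be exchanged for
  -- those at `t / s²`, which makes a raised vector appear. For `w = 0` no regularity at that point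
  -- is needed.
  have hW : (-(s * I * t⁻¹ / (t + t⁻¹))) • X w + (s⁻¹ * s⁻¹ / (t + t⁻¹)) • Y w +
      ((diag₂ s A₁ A₂ t - I * s⁻¹ / t * diag₁ s A₁ A₂ t) / (t + t⁻¹)) • w =
      (I / (s ^ 2 * (t + t⁻¹))) • raise s A₁ A₂ (t / s ^ 2) X Y w := by
    rcases hw with rfl | r'
    · simp
    · have e : diag₂ s A₁ A₂ t - I * s⁻¹ / t * diag₁ s A₁ A₂ t =
          (s ^ 2)⁻¹ * diag₂ s A₁ A₂ (t / s ^ 2) - I * s / t * diag₁ s A₁ A₂ (t / s ^ 2) := by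
        linear_combination diag_lower hs h4 A₁ A₂ r r'
      rw [raise_apply, e]
      generalize diag₁ s A₁ A₂ (t / s ^ 2) = b₁
      generalize diag₂ s A₁ A₂ (t / s ^ 2) = b₂
      generalize t + t⁻¹ = T at *
      match_scalars <;> field_simp <;> ring_nf <;> simp only [I_sq] <;> ring
  have hP : (s * I * t * d / (t + t⁻¹)) • X p + (s⁻¹ * s⁻¹ * d / (t + t⁻¹)) • Y p +
      (d * (diag₂ s A₁ A₂ t + I * s⁻¹ * t * diag₁ s A₁ A₂ t) / (t + t⁻¹)) • p =
      -((I / (s ^ 2 * (t + t⁻¹))) • d • v) := by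
    rcases hp with rfl | ⟨r', hl⟩
    · simp
    · have e : diag₂ s A₁ A₂ t + I * s⁻¹ * t * diag₁ s A₁ A₂ t =
          (s ^ 2)⁻¹ * diag₂ s A₁ A₂ (t * s ^ 2) + I * s * t * diag₁ s A₁ A₂ (t * s ^ 2) := by
        linear_combination diag_raise hs h4 A₁ A₂ r r'
      rw [← hl, lower_apply, e]
      generalize diag₁ s A₁ A₂ (t * s ^ 2) = b₁
      generalize diag₂ s A₁ A₂ (t * s ^ 2) = b₂
      generalize t + t⁻¹ = T at *
      match_scalars <;> field_simp <;> ring_nf <;> simp only [I_sq] <;> ring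
  have hXY : X (Y v) = (I / (t + t⁻¹)) • (t • d • X p - t⁻¹ • X w) - diag₂ s A₁ A₂ t • X v := by
    conv_lhs => rw [hY]
    simp
  have hYX : Y (X v) = (-s⁻¹ / (t + t⁻¹)) • (d • Y p + Y w) - diag₁ s A₁ A₂ t • Y v := by
    conv_lhs => rw [hX]
    simp
  rw [hXY, hYX, hX, hY]
  generalize diag₁ s A₁ A₂ t = b₁ at *
  generalize diag₂ s A₁ A₂ t = b₂ at *
  generalize t + t⁻¹ = T at *
  linear_combination (norm := (match_scalars <;> (field_simp; ring))) hW + hP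

end Ladder

/-! ### Distinct eigenvalues along a ladder -/

section Chain

variable {s t : ℂ}

theorem lev_surjective (hs : s ≠ 0) (h4 : s ^ 4 ≠ 1) (c : ℂ) : ∃ t, t ≠ 0 ∧ lev s t = c := by
  have h1 := sq_sub_one_ne h4
  have h2 := sq_add_one_ne h4
  obtain ⟨d, hd⟩ : ∃ d, d = I * c * (s ^ 2 - (s ^ 2)⁻¹) := ⟨_, rfl⟩
  obtain ⟨t, ht⟩ := IsAlgClosed.exists_eval₂_eq_zero (RingHom.id ℂ)
    (Polynomial.X ^ 2 - Polynomial.C d * Polynomial.X - 1 : Polynomial ℂ) (by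
      have : (Polynomial.X ^ 2 - Polynomial.C d * Polynomial.X - 1 : Polynomial ℂ).degree = 2 := by
        compute_degree!
      rw [this]; norm_num)
  have ht : t ^ 2 - d * t - 1 = 0 := by simpa using ht
  have h0 : t ≠ 0 := by
    rintro rfl
    norm_num at ht
  refine ⟨t, h0, ?_⟩
  have h3 : s ^ 2 - (s ^ 2)⁻¹ ≠ 0 := by
    have : s ^ 2 - (s ^ 2)⁻¹ = (s ^ 2 - 1) * (s ^ 2 + 1) / s ^ 2 := by field_simp; ring
    rw [this]
    exact div_ne_zero (mul_ne_zero h1 h2) (pow_ne_zero _ hs)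
  have : t - t⁻¹ = d := by field_simp; linear_combination ht
  rw [lev, qn, this, hd, mul_div_cancel_right₀ _ h3]
  linear_combination -c * I_sq

/-- By `lev_inj` a coincidence means either `r^(l-k) = 1`, so that `q` is a root of unity, or that
the two parameters have product `-1`. In the latter case the middle of the ladder violates
regularity: condition `mid` if `k + l` is even, `up` or `down` if it is odd. -/
theorem lev_chain_ne (hs : s ≠ 0) (hroot : ∀ n : ℕ, 0 < n → (s ^ 2) ^ n ≠ 1) (ht : t ≠ 0) {r : ℂ}
    (hr : r = s ^ 2 ∨ r = (s ^ 2)⁻¹) {k l : ℕ} (hkl : k < l)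
    (hreg : ∀ m, k ≤ m → m < l → Reg s (t * r ^ m)) : lev s (t * r ^ k) ≠ lev s (t * r ^ l) := by
  have h4 : s ^ 4 ≠ 1 := by have := hroot 2 (by norm_num); rwa [← pow_mul] at this
  have hr0 : r ≠ 0 := by rcases hr with rfl | rfl <;> positivity
  have hrr : ∀ n : ℕ, 0 < n → r ^ n ≠ 1 := by
    rcases hr with rfl | rfl
    · exact hroot
    · intro n hn h
      rw [inv_pow, inv_eq_one] at h
      exact hroot n hn h
  intro h
  rcases lev_inj h4 hs (by positivity) (by positivity) h with h | h
  · obtain ⟨m, rfl⟩ := Nat.exists_eq_add_of_lt hkl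
    refine hrr (m + 1) (by omega) ?_
    have h' := mul_left_cancel₀ ht h
    rw [add_assoc, pow_add] at h'
    exact mul_left_cancel₀ (pow_ne_zero k hr0) (by rw [← h', mul_one])
  · rcases Nat.even_or_odd' (k + l) with ⟨m, hm | hm⟩
    · refine (hreg m (by omega) (by omega)).mid ?_
      have : (t * r ^ m) ^ 2 = t * r ^ k * (t * r ^ l) := by
        have : t * r ^ k * (t * r ^ l) = t ^ 2 * r ^ (k + l) := by ring
        rw [this, hm]; ring
      rw [this, h]; ring
    · have h5 := hreg m (by omega) (by omega)
      have h6 : (t * r ^ m) ^ 2 * r = -1 := by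
        rw [← h]
        have : t * r ^ k * (t * r ^ l) = t ^ 2 * r ^ (k + l) := by ring
        rw [this, hm]; ring
      rcases hr with hr | hr
      · apply h5.up
        rw [← hr, h6]; ring
      · apply h5.down
        have : s ^ 2 = r⁻¹ := by rw [hr, inv_inv]
        rw [this]
        field_simp
        linear_combination h6

theorem lev_chain_injOn (hs : s ≠ 0) (hroot : ∀ n : ℕ, 0 < n → (s ^ 2) ^ n ≠ 1) (ht : t ≠ 0)
    {r : ℂ} (hr : r = s ^ 2 ∨ r = (s ^ 2)⁻¹) {k l n : ℕ} (hk : k < n) (hl : l < n)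
    (hreg : ∀ m, m < n → Reg s (t * r ^ m))
    (h : lev s (t * r ^ k) = lev s (t * r ^ l)) : k = l := by
  rcases lt_trichotomy k l with hlt | heq | hlt
  · exact (lev_chain_ne hs hroot ht hr hlt (fun m _ hm => hreg m (hm.trans hl)) h).elim
  · exact heq
  · exact (lev_chain_ne hs hroot ht hr hlt (fun m _ hm => hreg m (hm.trans hk)) h.symm).elim

end Chain

/-! ### Highest vectors and finite chains -/

section Ladder

variable {V : Type*} [AddCommGroup V] [Module ℂ V]
variable {s t A₁ A₂ A₃ : ℂ} {X Y Z : Module.End ℂ V}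

/-- This is the first relation, evaluated on `v` by `xy_apply` and solved for the raised vector. -/
theorem Relations.raise_lower (R : Relations s A₁ A₂ A₃ X Y Z) (hs : s ≠ 0) (h4 : s ^ 4 ≠ 1)
    (r : Reg s t) {v p : V} {d : ℂ} (hZ : Z v = lev s t • v)
    (hr : raise s A₁ A₂ t X Y v = d • p)
    (hp : d = 0 ∨ Reg s (t * s ^ 2) ∧ lower s A₁ A₂ (t * s ^ 2) X Y p = v)
    (hw : lower s A₁ A₂ t X Y v = 0 ∨ Reg s (t / s ^ 2)) :
    raise s A₁ A₂ (t / s ^ 2) X Y (lower s A₁ A₂ t X Y v) = (d + incr s A₁ A₂ A₃ t) • v := by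
  have ht := r.ne
  have hT : t + t⁻¹ ≠ 0 := by
    have : t + t⁻¹ = (t ^ 2 + 1) / t := by field_simp
    rw [this]
    exact div_ne_zero r.mid ht
  have hX := X_eq (A₁ := A₁) (A₂ := A₂) (X := X) (Y := Y) hs ht r.mid v
  have hY := Y_eq (s := s) (A₁ := A₁) (A₂ := A₂) (X := X) (Y := Y) ht r.mid v
  rw [hr] at hX hY
  have h := xy_apply hs h4 r hX hY hp hw
  rw [R.xy, hZ] at h
  generalize raise s A₁ A₂ (t / s ^ 2) X Y (lower s A₁ A₂ t X Y v) = u at *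
  have h' := congrArg (fun x => (-I * s ^ 2 * (t + t⁻¹)) • x) h
  simp only [smul_add, smul_smul, smul_sub] at h'
  have e : -I * s ^ 2 * (t + t⁻¹) * (I / (s ^ 2 * (t + t⁻¹))) = 1 := by
    generalize t + t⁻¹ = T at *
    field_simp; linear_combination -I_sq
  rw [e, one_smul, ← mul_assoc, e, one_mul] at h'
  rw [incr]
  linear_combination (norm := (match_scalars <;> ring)) -h'

/-- Otherwise raising never stops and yields infinitely many eigenvectors with distinct eigenvalues.
-/
theorem Relations.exists_highest [FiniteDimensional ℂ V] [Nontrivial V]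
    (R : Relations s A₁ A₂ A₃ X Y Z) (hs : s ≠ 0)
    (hroot : ∀ n : ℕ, 0 < n → (s ^ 2) ^ n ≠ 1)
    (hcl : ∀ t, t ≠ 0 → Z.HasEigenvalue (lev s t) → Reg s t) :
    ∃ t v, t ≠ 0 ∧ v ≠ 0 ∧ Z v = lev s t • v ∧ raise s A₁ A₂ t X Y v = 0 := by
  have h4 : s ^ 4 ≠ 1 := by have := hroot 2 (by norm_num); rwa [← pow_mul] at this
  by_contra! hcon
  obtain ⟨c, hc⟩ := Module.End.exists_eigenvalue Z
  obtain ⟨t, ht, rfl⟩ := lev_surjective hs h4 c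
  obtain ⟨v, hv⟩ := hc.exists_hasEigenvector
  let u : ℕ → V := fun k => Nat.rec v (fun k w => raise s A₁ A₂ (t * (s ^ 2) ^ k) X Y w) k
  have hreg : ∀ k, ∀ w, Z.HasEigenvector (lev s (t * (s ^ 2) ^ k)) w →
      Reg s (t * (s ^ 2) ^ k) := fun k w hw =>
    hcl _ (by positivity) (Module.End.hasEigenvalue_of_hasEigenvector hw)
  have hu : ∀ k, Z.HasEigenvector (lev s (t * (s ^ 2) ^ k)) (u k) := by
    intro k
    induction k with
    | zero => simpa [u] using hv
    | succ k ih =>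
      have hZ := ih.apply_eq_smul
      rw [Module.End.hasEigenvector_iff, Module.End.mem_eigenspace_iff]
      have e : t * (s ^ 2) ^ (k + 1) = t * (s ^ 2) ^ k * s ^ 2 := by ring
      exact ⟨by rw [e]; exact R.Z_raise hs h4 (hreg k _ ih) hZ,
        hcon _ _ (by positivity) ih.2 hZ⟩
  have hli := Module.End.eigenvectors_linearIndependent' Z (fun k => lev s (t * (s ^ 2) ^ k))
    (fun k l hkl => lev_chain_injOn (n := max k l + 1) hs hroot ht (Or.inl rfl) (by omega)
      (by omega) (fun m _ => hreg m _ (hu m)) hkl) u hu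
  have := hli.finite
  exact not_finite ℕ

/-- A chain of eigenvectors `v 0, …, v (n - 1)` of `I₃`, linked by the lowering operators and
starting at a highest vector. -/
structure IsChain (s A₁ A₂ A₃ t : ℂ) (X Y Z : Module.End ℂ V) (v : ℕ → V) (d : ℕ → ℂ) (n : ℕ) :
    Prop where
  ne : ∀ j < n, v j ≠ 0
  last : v n = 0
  reg : ∀ j < n, Reg s (t * (s ^ 2)⁻¹ ^ j)
  eigen : ∀ j < n, Z (v j) = lev s (t * (s ^ 2)⁻¹ ^ j) • v j
  zero : d 0 = 0
  succ : ∀ j, d (j + 1) = d j + incr s A₁ A₂ A₃ (t * (s ^ 2)⁻¹ ^ j)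
  up : ∀ j < n, raise s A₁ A₂ (t * (s ^ 2)⁻¹ ^ j) X Y (v j) = d j • v (j - 1)
  down : ∀ j, lower s A₁ A₂ (t * (s ^ 2)⁻¹ ^ j) X Y (v j) = v (j + 1)
  final : d n = 0

theorem Relations.exists_isChain [FiniteDimensional ℂ V] [Nontrivial V]
    (R : Relations s A₁ A₂ A₃ X Y Z) (hs : s ≠ 0)
    (hroot : ∀ n : ℕ, 0 < n → (s ^ 2) ^ n ≠ 1)
    (hcl : ∀ t, t ≠ 0 → Z.HasEigenvalue (lev s t) → Reg s t) :
    ∃ t v d n, t ≠ 0 ∧ 0 < n ∧ IsChain s A₁ A₂ A₃ t X Y Z v d n := by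
  have h4 : s ^ 4 ≠ 1 := by have := hroot 2 (by norm_num); rwa [← pow_mul] at this
  obtain ⟨t, v₀, ht, hv₀, hZ₀, hr₀⟩ := R.exists_highest hs hroot hcl
  let v : ℕ → V := fun k => Nat.rec v₀ (fun k w => lower s A₁ A₂ (t * (s ^ 2)⁻¹ ^ k) X Y w) k
  let d : ℕ → ℂ := fun k =>
    Nat.rec 0 (fun k x => x + incr s A₁ A₂ A₃ (t * (s ^ 2)⁻¹ ^ k)) k
  have hreg : ∀ k, ∀ w, Z.HasEigenvector (lev s (t * (s ^ 2)⁻¹ ^ k)) w →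
      Reg s (t * (s ^ 2)⁻¹ ^ k) := fun k w hw =>
    hcl _ (by positivity) (Module.End.hasEigenvalue_of_hasEigenvector hw)
  have hstep : ∀ k, t * (s ^ 2)⁻¹ ^ (k + 1) = t * (s ^ 2)⁻¹ ^ k / s ^ 2 := fun k => by
    rw [pow_succ, div_eq_mul_inv, mul_assoc]
  have hback : ∀ k, t * (s ^ 2)⁻¹ ^ (k + 1) * s ^ 2 = t * (s ^ 2)⁻¹ ^ k := fun k => by
    rw [hstep]; field_simp
  have hu : ∀ k, (∀ j ≤ k, v j ≠ 0) → Z.HasEigenvector (lev s (t * (s ^ 2)⁻¹ ^ k)) (v k) := by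
    intro k
    induction k with
    | zero =>
      intro _
      rw [Module.End.hasEigenvector_iff, Module.End.mem_eigenspace_iff]
      simpa [v] using ⟨hZ₀, hv₀⟩
    | succ k ih =>
      intro hne
      have ih := ih fun j hj => hne j (by omega)
      rw [Module.End.hasEigenvector_iff, Module.End.mem_eigenspace_iff]
      exact ⟨by rw [hstep]; exact R.Z_lower hs h4 (hreg k _ ih) ih.apply_eq_smul,
        hne _ le_rfl⟩
  have hex : ∃ n, v n = 0 := by
    by_contra! hne
    have hu' : ∀ k, _ := fun k => hu k fun j _ => hne j
    have hli := Module.End.eigenvectors_linearIndependent' Z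
      (fun k => lev s (t * (s ^ 2)⁻¹ ^ k))
      (fun k l hkl => lev_chain_injOn (n := max k l + 1) hs hroot ht (Or.inr rfl) (by omega)
        (by omega) (fun m _ => hreg m _ (hu' m)) hkl) v hu'
    have := hli.finite
    exact not_finite ℕ
  obtain ⟨n, hn, hmin⟩ : ∃ n, v n = 0 ∧ ∀ j < n, v j ≠ 0 := by
    classical exact ⟨Nat.find hex, Nat.find_spec hex, fun j hj => Nat.find_min hex hj⟩
  have hpos : 0 < n := by
    rcases Nat.eq_zero_or_pos n with rfl | h
    · exact (hv₀ hn).elim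
    · exact h
  have hu' : ∀ k < n, Z.HasEigenvector (lev s (t * (s ^ 2)⁻¹ ^ k)) (v k) := fun k hk =>
    hu k fun j hj => hmin j (by omega)
  have hR : ∀ k < n, Reg s (t * (s ^ 2)⁻¹ ^ k) := fun k hk => hreg k _ (hu' k hk)
  have hup : ∀ j, j ≤ n → raise s A₁ A₂ (t * (s ^ 2)⁻¹ ^ j) X Y (v j) = d j • v (j - 1) := by
    intro j
    induction j with
    | zero => intro _; simpa [d, v] using hr₀
    | succ j ih =>
      intro hj
      rw [hstep]
      refine R.raise_lower hs h4 (hR j (by omega)) (hu' j (by omega)).apply_eq_smul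
        (ih (by omega)) ?_ ?_
      · cases j with
        | zero => exact Or.inl rfl
        | succ j =>
          right
          rw [hback]
          exact ⟨hR j (by omega), rfl⟩
      -- The parameter after the last vector may be irregular, but there the lowered vector is zero.
      · rcases Nat.lt_or_ge (j + 1) n with h | h
        · right
          rw [← hstep]
          exact hR _ h
        · left
          obtain rfl : n = j + 1 := by omega
          exact hn
  refine ⟨t, v, d, n, ht, hpos, hmin, hn, hR, fun j hj => (hu' j hj).apply_eq_smul, rfl,
    fun j => rfl, fun j hj => hup j hj.le, fun j => rfl, ?_⟩
  -- Raising `v n = 0` gives `d n • v (n - 1) = 0` with `v (n - 1) ≠ 0`.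
  have h := hup n le_rfl
  rw [hn, map_zero] at h
  exact (smul_eq_zero.1 h.symm).resolve_right (hmin _ (by omega))

end Ladder

/-! ### Translation to powers of `q` and solution for the parameters -/

section Dictionary

variable {h : ℂ}

theorem qpow_add (h a b : ℂ) : qpow h (a + b) = qpow h a * qpow h b := by
  simp [qpow, add_mul, Complex.exp_add]

theorem qpow_ne_zero (h a : ℂ) : qpow h a ≠ 0 := Complex.exp_ne_zero _

theorem qpow_neg (h a : ℂ) : qpow h (-a) = (qpow h a)⁻¹ := by
  simp [qpow, Complex.exp_neg]

theorem qpow_sub (h a b : ℂ) : qpow h (a - b) = qpow h a / qpow h b := by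
  rw [sub_eq_add_neg, qpow_add, qpow_neg, div_eq_mul_inv]

theorem qpow_nat_mul (h a : ℂ) (n : ℕ) : qpow h (n * a) = qpow h a ^ n := by
  rw [qpow, qpow, ← Complex.exp_nat_mul, mul_assoc]

theorem qpow_two_mul (h a : ℂ) : qpow h (2 * a) = qpow h a ^ 2 := by
  exact_mod_cast qpow_nat_mul h a 2

theorem qpow_one (h : ℂ) : qpow h 1 = qpow h (1 / 2) ^ 2 := by
  rw [← qpow_two_mul]; norm_num

theorem qpow_sub_nat (h μ : ℂ) (j : ℕ) :
    qpow h (μ - j) = qpow h μ * (qpow h (1 / 2) ^ 2)⁻¹ ^ j := by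
  rw [qpow_sub, ← qpow_one, inv_pow, ← qpow_nat_mul, mul_one, div_eq_mul_inv]

/-- `q` is not a root of unity. -/
def Generic (h : ℂ) : Prop := ∀ n : ℕ, 0 < n → (qpow h (1 / 2) ^ 2) ^ n ≠ 1

theorem Generic.pow_four (G : Generic h) : qpow h (1 / 2) ^ 4 ≠ 1 := by
  have := G 2 (by norm_num)
  rwa [← pow_mul] at this

theorem Generic.h_ne (G : Generic h) : h ≠ 0 := by
  rintro rfl
  exact G 1 one_pos (by simp [qpow])

theorem Generic.sub_ne (G : Generic h) : qpow h (1 / 2) - (qpow h (1 / 2))⁻¹ ≠ 0 := by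
  have hs := qpow_ne_zero h (1 / 2)
  have e : qpow h (1 / 2) - (qpow h (1 / 2))⁻¹ = (qpow h (1 / 2) ^ 2 - 1) / qpow h (1 / 2) := by
    field_simp
  rw [e]
  exact div_ne_zero (sq_sub_one_ne G.pow_four) hs

theorem Generic.add_ne (G : Generic h) : qpow h (1 / 2) + (qpow h (1 / 2))⁻¹ ≠ 0 := by
  have hs := qpow_ne_zero h (1 / 2)
  have e : qpow h (1 / 2) + (qpow h (1 / 2))⁻¹ = (qpow h (1 / 2) ^ 2 + 1) / qpow h (1 / 2) := by
    field_simp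
  rw [e]
  exact div_ne_zero (sq_add_one_ne G.pow_four) hs

theorem Generic.qpow_surjective (G : Generic h) {t : ℂ} (ht : t ≠ 0) : ∃ x, qpow h x = t :=
  ⟨Complex.log t / h, by rw [qpow, div_mul_cancel₀ _ G.h_ne, Complex.exp_log ht]⟩

theorem qnum_eq (h x : ℂ) : qnum h x = qn (qpow h (1 / 2)) (qpow h x) := by
  rw [qnum, qn, qpow_neg, qpow_neg, qpow_one]

theorem Lam_eq (G : Generic h) (μ j : ℂ) : Lam h μ j =
    (qpow h (μ - j) * qpow h (1 / 2) - (qpow h (μ - j) * qpow h (1 / 2))⁻¹) /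
      (qpow h (1 / 2) - (qpow h (1 / 2))⁻¹) := by
  have hs := qpow_ne_zero h (1 / 2)
  have ht := qpow_ne_zero h (μ - j)
  have hw := sq_sub_one_ne G.pow_four
  have hk := sq_add_one_ne G.pow_four
  rw [Lam, qnum_eq, qnum_eq, qpow_add, qpow_one, qn_eq hs G.pow_four ht,
    qn_eq hs G.pow_four (by positivity)]
  field_simp
  ring

theorem g_eq (G : Generic h) (μ j : ℂ) : g h μ j =
    (qpow h (μ - j) * qpow h (1 / 2) + (qpow h (μ - j) * qpow h (1 / 2))⁻¹) /
      (qpow h (1 / 2) + (qpow h (1 / 2))⁻¹) := by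
  have hs := qpow_ne_zero h (1 / 2)
  have ht := qpow_ne_zero h (μ - j)
  have hw := sq_sub_one_ne G.pow_four
  have hk := sq_add_one_ne G.pow_four
  rw [g, qnum_eq, qnum_eq, qpow_add, qpow_one, qn_eq hs G.pow_four ht,
    qn_eq hs G.pow_four (by positivity)]
  field_simp
  ring

/-- Identifies the denominators in the model with the determinant `den` of the system for the
diagonal entries. -/
theorem g_mul_g (G : Generic h) (μ j : ℂ) :
    g h μ j * g h μ (j + 1) = den (qpow h (1 / 2)) (qpow h (μ - j)) := by
  have hs := qpow_ne_zero h (1 / 2)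
  have ht := qpow_ne_zero h (μ - j)
  have hw := sq_sub_one_ne G.pow_four
  have hk := sq_add_one_ne G.pow_four
  have e : qpow h (μ - (j + 1)) = qpow h (μ - j) / qpow h (1 / 2) ^ 2 := by
    rw [← qpow_one, ← qpow_sub]; congr 1; ring
  rw [g_eq G, g_eq G, e, den_eq hs G.pow_four ht]
  field_simp

theorem Generic.Lam_surjective (G : Generic h) (μ x : ℂ) : ∃ j, Lam h μ j = x := by
  have hs := qpow_ne_zero h (1 / 2)
  have hn : qpow h 1 - qpow h (-1) ≠ 0 := by
    have e : qpow h 1 - qpow h (-1) = (qpow h (1 / 2) - (qpow h (1 / 2))⁻¹) *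
      (qpow h (1 / 2) + (qpow h (1 / 2))⁻¹) := by rw [qpow_neg, qpow_one]; field_simp; ring
    rw [e]
    exact mul_ne_zero G.sub_ne G.add_ne
  -- The level is scaled so that `y - y⁻¹ = x (s - s⁻¹)`.
  obtain ⟨y, hy0, hy⟩ := lev_surjective hs G.pow_four
    (-I * (x * (qpow h (1 / 2) - (qpow h (1 / 2))⁻¹) / (qpow h 1 - qpow h (-1))))
  have hy := mul_left_cancel₀ (neg_ne_zero.2 I_ne_zero) hy
  rw [qn, ← qpow_one, ← qpow_neg, div_left_inj' hn] at hy
  obtain ⟨z, hz⟩ := G.qpow_surjective hy0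
  refine ⟨μ + 1 / 2 - z, ?_⟩
  have e : qpow h (μ - (μ + 1 / 2 - z)) * qpow h (1 / 2) = y := by
    rw [← qpow_add, ← hz]; congr 1; ring
  rw [Lam_eq G, e, hy, mul_div_cancel_right₀ _ G.sub_ne]

theorem Generic.Lam_inj (G : Generic h) {μ j k : ℂ} (hjk : Lam h μ j = Lam h μ k) :
    qpow h (j - k) = 1 ∨ qpow h (2 * μ + 1 - j - k) = -1 := by
  have hs := qpow_ne_zero h (1 / 2)
  rw [Lam_eq G, Lam_eq G, div_left_inj' G.sub_ne] at hjk
  have hl : lev (qpow h (1 / 2)) (qpow h (μ - j) * qpow h (1 / 2)) =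
      lev (qpow h (1 / 2)) (qpow h (μ - k) * qpow h (1 / 2)) := by
    rw [lev, lev, qn, qn, hjk]
  rcases lev_inj G.pow_four hs (mul_ne_zero (qpow_ne_zero _ _) hs)
    (mul_ne_zero (qpow_ne_zero _ _) hs) hl with e | e
  · left
    have e := mul_right_cancel₀ hs e
    have : j - k = (μ - k) - (μ - j) := by ring
    rw [this, qpow_sub, e, div_self (qpow_ne_zero _ _)]
  · right
    rw [← e, ← qpow_add, ← qpow_add, ← qpow_add]
    congr 1; ring

/-- The elementary symmetric functions of `Λ_0, Λ_{j₁}, Λ_{j₂}, Λ_{j₃}`. -/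
def sym₁ (h μ j₁ j₂ j₃ : ℂ) : ℂ := Lam h μ 0 + Lam h μ j₁ + Lam h μ j₂ + Lam h μ j₃

/-- The second elementary symmetric function. -/
def sym₂ (h μ j₁ j₂ j₃ : ℂ) : ℂ :=
  Lam h μ 0 * Lam h μ j₁ + Lam h μ 0 * Lam h μ j₂ + Lam h μ 0 * Lam h μ j₃
    + Lam h μ j₁ * Lam h μ j₂ + Lam h μ j₁ * Lam h μ j₃ + Lam h μ j₂ * Lam h μ j₃

/-- The third elementary symmetric function. -/
def sym₃ (h μ j₁ j₂ j₃ : ℂ) : ℂ :=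
  Lam h μ 0 * Lam h μ j₁ * Lam h μ j₂ + Lam h μ 0 * Lam h μ j₁ * Lam h μ j₃
    + Lam h μ 0 * Lam h μ j₂ * Lam h μ j₃ + Lam h μ j₁ * Lam h μ j₂ * Lam h μ j₃

/-- The fourth elementary symmetric function. -/
def sym₄ (h μ j₁ j₂ j₃ : ℂ) : ℂ := Lam h μ 0 * Lam h μ j₁ * Lam h μ j₂ * Lam h μ j₃

theorem D_eq (G : Generic h) (μ j₁ j₂ j₃ j : ℂ) : D h μ j₁ j₂ j₃ j =
    quartD (qpow h (1 / 2)) (sym₁ h μ j₁ j₂ j₃) (sym₂ h μ j₁ j₂ j₃) (sym₃ h μ j₁ j₂ j₃)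
      (sym₄ h μ j₁ j₂ j₃) (qpow h (μ - j) * qpow h (1 / 2)) := by
  have hw := G.sub_ne
  have hk := G.add_ne
  rw [D, quartD, g_eq G, ← Lam_eq G, sym₁, sym₂, sym₃, sym₄, qpow_neg, qpow_one]
  generalize qpow h (1 / 2) - (qpow h (1 / 2))⁻¹ = w at *
  generalize qpow h (1 / 2) + (qpow h (1 / 2))⁻¹ = k at *
  generalize qpow h (μ - j) * qpow h (1 / 2) + (qpow h (μ - j) * qpow h (1 / 2))⁻¹ = Y
  -- If `g` vanishes, both sides are zero because division by zero gives zero.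
  by_cases hY : Y = 0
  · simp [hY]
  · field_simp
    ring

/-- The conditions on the structure constants under which the quartic with symmetric functions
`e₁, …, e₄` solves the recursion. -/
structure Match (s e₁ e₂ e₃ e₄ A₁ A₂ A₃ : ℂ) : Prop where
  h₃ : A₃ = I * e₁ / (s + s⁻¹) ^ 2
  mul : A₁ * A₂ = I * (s - s⁻¹) * (4 / (s - s⁻¹) ^ 2 * e₁ - e₃) / (s + s⁻¹) ^ 4
  sq : A₁ ^ 2 + A₂ ^ 2 = (s - s⁻¹) ^ 2 *
      (e₄ - 4 / (s - s⁻¹) ^ 2 * e₂ + (4 / (s - s⁻¹) ^ 2) ^ 2) / (s + s⁻¹) ^ 4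

theorem parA₃_eq (h μ j₁ j₂ j₃ : ℂ) : parA₃ h μ j₁ j₂ j₃ =
    I * sym₁ h μ j₁ j₂ j₃ / (qpow h (1 / 2) + (qpow h (1 / 2))⁻¹) ^ 2 := by
  rw [parA₃, sym₁, qpow_neg]; ring

/-- Every exponent in the formulas for `A₁` and `A₂` is a combination of the four numbers `(μ + 1/2
- j_k)/2` with coefficients `±1`. -/
theorem qpow_half_combo (h a b c d : ℂ) (e₀ e₁ e₂ e₃ : ℤ) {x : ℂ}
    (hx : x = e₀ * a + e₁ * b + e₂ * c + e₃ * d) :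
    qpow h x = qpow h a ^ e₀ * qpow h b ^ e₁ * qpow h c ^ e₂ * qpow h d ^ e₃ := by
  rw [hx]
  simp only [qpow, add_mul, Complex.exp_add, ← Complex.exp_int_mul, mul_assoc]

theorem parA₁_eq (h μ j₁ j₂ j₃ : ℂ) : parA₁ h μ j₁ j₂ j₃ =
    I / ((qpow h (1 / 2) + (qpow h (1 / 2))⁻¹) * (qpow h 1 - (qpow h 1)⁻¹)) *
      S₁ (qpow h ((μ + 1 / 2) / 2)) (qpow h ((μ + 1 / 2 - j₁) / 2))
        (qpow h ((μ + 1 / 2 - j₂) / 2)) (qpow h ((μ + 1 / 2 - j₃) / 2)) := by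
  rw [parA₁, qpow_neg, qpow_neg, S₁]
  congr 1
  have E := qpow_half_combo h ((μ + 1 / 2) / 2) ((μ + 1 / 2 - j₁) / 2) ((μ + 1 / 2 - j₂) / 2)
    ((μ + 1 / 2 - j₃) / 2)
  rw [E 1 (-1) (-1) (-1) (x := (j₁ + j₂ + j₃ - 2 * μ - 1) / 2) (by push_cast; ring),
    E (-1) 1 (-1) (-1) (x := (-j₁ + j₂ + j₃ - 2 * μ - 1) / 2) (by push_cast; ring),
    E (-1) (-1) 1 (-1) (x := (j₁ - j₂ + j₃ - 2 * μ - 1) / 2) (by push_cast; ring),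
    E (-1) (-1) (-1) 1 (x := (j₁ + j₂ - j₃ - 2 * μ - 1) / 2) (by push_cast; ring),
    E 1 1 1 (-1) (x := (2 * μ + 1 - j₁ - j₂ + j₃) / 2) (by push_cast; ring),
    E (-1) 1 1 1 (x := (2 * μ + 1 - j₁ - j₂ - j₃) / 2) (by push_cast; ring),
    E 1 (-1) 1 1 (x := (2 * μ + 1 + j₁ - j₂ - j₃) / 2) (by push_cast; ring),
    E 1 1 (-1) 1 (x := (2 * μ + 1 - j₁ + j₂ - j₃) / 2) (by push_cast; ring)]
  simp only [zpow_neg, zpow_one]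
  field_simp

theorem parA₂_eq (h μ j₁ j₂ j₃ : ℂ) : parA₂ h μ j₁ j₂ j₃ =
    1 / ((qpow h (1 / 2) + (qpow h (1 / 2))⁻¹) * (qpow h 1 - (qpow h 1)⁻¹)) *
      S₂ (qpow h ((μ + 1 / 2) / 2)) (qpow h ((μ + 1 / 2 - j₁) / 2))
        (qpow h ((μ + 1 / 2 - j₂) / 2)) (qpow h ((μ + 1 / 2 - j₃) / 2)) := by
  rw [parA₂, qpow_neg h (1 / 2), qpow_neg h 1, S₂]
  congr 1
  have E := qpow_half_combo h ((μ + 1 / 2) / 2) ((μ + 1 / 2 - j₁) / 2) ((μ + 1 / 2 - j₂) / 2)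
    ((μ + 1 / 2 - j₃) / 2)
  rw [E (-1) (-1) (-1) (-1) (x := -2 * μ - 1 + (j₁ + j₂ + j₃) / 2) (by push_cast; ring),
    E 1 1 (-1) (-1) (x := (-j₁ + j₂ + j₃) / 2) (by push_cast; ring),
    E 1 (-1) 1 (-1) (x := (j₁ - j₂ + j₃) / 2) (by push_cast; ring),
    E 1 (-1) (-1) 1 (x := (j₁ + j₂ - j₃) / 2) (by push_cast; ring),
    E (-1) (-1) 1 1 (x := -(-j₁ + j₂ + j₃) / 2) (by push_cast; ring),
    E (-1) 1 (-1) 1 (x := -(j₁ - j₂ + j₃) / 2) (by push_cast; ring),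
    E (-1) 1 1 (-1) (x := -(j₁ + j₂ - j₃) / 2) (by push_cast; ring),
    E 1 1 1 1 (x := 2 * μ + 1 - (j₁ + j₂ + j₃) / 2) (by push_cast; ring)]
  simp only [zpow_neg, zpow_one]
  field_simp
  ring

theorem Generic.match_par (G : Generic h) (μ j₁ j₂ j₃ : ℂ) :
    Match (qpow h (1 / 2)) (sym₁ h μ j₁ j₂ j₃) (sym₂ h μ j₁ j₂ j₃) (sym₃ h μ j₁ j₂ j₃)
      (sym₄ h μ j₁ j₂ j₃) (parA₁ h μ j₁ j₂ j₃) (parA₂ h μ j₁ j₂ j₃) (parA₃ h μ j₁ j₂ j₃) := by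
  have hw := G.sub_ne
  have hk := G.add_ne
  have hs := qpow_ne_zero h (1 / 2)
  have hz : ∀ j, ∃ l, Lam h μ j = l / (qpow h (1 / 2) - (qpow h (1 / 2))⁻¹) ∧
      l = qpow h ((μ + 1 / 2 - j) / 2) ^ 2 - (qpow h ((μ + 1 / 2 - j) / 2) ^ 2)⁻¹ := by
    intro j
    refine ⟨_, Lam_eq G μ j, ?_⟩
    have : qpow h ((μ + 1 / 2 - j) / 2) ^ 2 = qpow h (μ - j) * qpow h (1 / 2) := by
      rw [← qpow_two_mul, ← qpow_add]; congr 1; ring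
    rw [this]
  obtain ⟨l₀, hl₀, k₀⟩ := hz 0
  obtain ⟨l₁, hl₁, k₁⟩ := hz j₁
  obtain ⟨l₂, hl₂, k₂⟩ := hz j₂
  obtain ⟨l₃, hl₃, k₃⟩ := hz j₃
  rw [sub_zero] at k₀
  have m1 := S₁_mul_S₂ (qpow_ne_zero _ _) (qpow_ne_zero _ _) (qpow_ne_zero _ _)
    (qpow_ne_zero _ _) k₀ k₁ k₂ k₃
  have m2 := S₂_sq_sub_S₁_sq (qpow_ne_zero _ _) (qpow_ne_zero _ _) (qpow_ne_zero _ _)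
    (qpow_ne_zero _ _) k₀ k₁ k₂ k₃
  have e : qpow h 1 - (qpow h 1)⁻¹ = (qpow h (1 / 2) - (qpow h (1 / 2))⁻¹) *
      (qpow h (1 / 2) + (qpow h (1 / 2))⁻¹) := by rw [qpow_one]; field_simp; ring
  refine ⟨parA₃_eq .., ?_, ?_⟩
  · rw [parA₁_eq, parA₂_eq, e, mul_mul_mul_comm, m1, sym₁, sym₃, hl₀, hl₁, hl₂, hl₃]
    generalize qpow h (1 / 2) - (qpow h (1 / 2))⁻¹ = w at *
    generalize qpow h (1 / 2) + (qpow h (1 / 2))⁻¹ = k at *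
    field_simp
  · rw [parA₁_eq, parA₂_eq, e, mul_pow, mul_pow, div_pow, I_sq]
    generalize qpow h (1 / 2) - (qpow h (1 / 2))⁻¹ = w at *
    generalize qpow h (1 / 2) + (qpow h (1 / 2))⁻¹ = k at *
    -- The factor `I` in `parA₁` turns the sum of squares into a multiple of `S₂² - S₁²`.
    have : ∀ x y : ℂ, -1 / (k * (w * k)) ^ 2 * x ^ 2 + (1 / (k * (w * k))) ^ 2 * y ^ 2 =
      (y ^ 2 - x ^ 2) / (k ^ 4 * w ^ 2) := by intro x y; field_simp; ring
    rw [this, m2, sym₂, sym₄, hl₀, hl₁, hl₂, hl₃]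
    field_simp
    ring

theorem Generic.match_of_mem (G : Generic h) {μ j₁ j₂ j₃ A₁ A₂ : ℂ}
    (hA : (A₁, A₂) ∈ parPairs h μ j₁ j₂ j₃) :
    Match (qpow h (1 / 2)) (sym₁ h μ j₁ j₂ j₃) (sym₂ h μ j₁ j₂ j₃) (sym₃ h μ j₁ j₂ j₃)
      (sym₄ h μ j₁ j₂ j₃) A₁ A₂ (parA₃ h μ j₁ j₂ j₃) := by
  have M := G.match_par μ j₁ j₂ j₃
  refine ⟨M.h₃, ?_, ?_⟩
  · rw [← M.mul]
    simp only [parPairs, Set.mem_insert_iff, Set.mem_singleton_iff, Prod.mk.injEq] at hA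
    rcases hA with ⟨rfl, rfl⟩ | ⟨rfl, rfl⟩ | ⟨rfl, rfl⟩ | ⟨rfl, rfl⟩ <;> ring
  · rw [← M.sq]
    simp only [parPairs, Set.mem_insert_iff, Set.mem_singleton_iff, Prod.mk.injEq] at hA
    rcases hA with ⟨rfl, rfl⟩ | ⟨rfl, rfl⟩ | ⟨rfl, rfl⟩ | ⟨rfl, rfl⟩ <;> ring

theorem Generic.mem_of_match (G : Generic h) {μ j₁ j₂ j₃ A₁ A₂ A₃ : ℂ}
    (M : Match (qpow h (1 / 2)) (sym₁ h μ j₁ j₂ j₃) (sym₂ h μ j₁ j₂ j₃) (sym₃ h μ j₁ j₂ j₃)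
      (sym₄ h μ j₁ j₂ j₃) A₁ A₂ A₃) :
    (A₁, A₂) ∈ parPairs h μ j₁ j₂ j₃ ∧ A₃ = parA₃ h μ j₁ j₂ j₃ := by
  have M' := G.match_par μ j₁ j₂ j₃
  refine ⟨?_, M.h₃.trans M'.h₃.symm⟩
  simp only [parPairs, Set.mem_insert_iff, Set.mem_singleton_iff, Prod.mk.injEq]
  exact eq_or_of_mul_eq_of_sq_add_sq_eq (M.mul.trans M'.mul.symm) (M.sq.trans M'.sq.symm)

theorem qpow_two_mul_ne_iff (h μ l : ℂ) :
    qpow h (2 * μ) ≠ -qpow h l ↔ qpow h (2 * μ - l) + 1 ≠ 0 := by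
  have hl := qpow_ne_zero h l
  rw [qpow_sub, Ne, Ne, not_iff_not]
  constructor
  · intro e; rw [e]; field_simp; ring
  · intro e; field_simp at e; linear_combination e

/-- The conditions `up`, `mid`, `down` at index `j` are the cases `l = 2j - 1`, `2j`, `2j + 1`. -/
theorem reg_qpow_iff (h μ : ℂ) (j : ℕ) : Reg (qpow h (1 / 2)) (qpow h (μ - j)) ↔
    ∀ l : ℤ, 2 * (j : ℤ) - 1 ≤ l → l ≤ 2 * j + 1 → qpow h (2 * μ) ≠ -qpow h l := by
  have hs := qpow_ne_zero h (1 / 2)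
  have e1 : qpow h (μ - j) ^ 2 = qpow h (2 * μ - (2 * j : ℤ)) := by
    rw [← qpow_two_mul]; congr 1; push_cast; ring
  have e2 : qpow h (μ - j) ^ 2 * qpow h (1 / 2) ^ 2 = qpow h (2 * μ - (2 * j - 1 : ℤ)) := by
    rw [← qpow_two_mul, ← qpow_two_mul, ← qpow_add]; congr 1; push_cast; ring
  have e3 : qpow h (μ - j) ^ 2 + qpow h (1 / 2) ^ 2 =
      qpow h (1 / 2) ^ 2 * (qpow h (2 * μ - (2 * j + 1 : ℤ)) + 1) := by
    rw [mul_add, mul_one, ← qpow_two_mul, ← qpow_two_mul, ← qpow_add]; congr 2; push_cast; ring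
  constructor
  · intro r l h1 h2
    rw [qpow_two_mul_ne_iff]
    obtain rfl | rfl | rfl : l = 2 * j - 1 ∨ l = 2 * j ∨ l = 2 * j + 1 := by omega
    · rw [← e2]; exact r.up
    · rw [← e1]; exact r.mid
    · have := r.down
      rw [e3] at this
      exact right_ne_zero_of_mul this
  · intro H
    simp only [qpow_two_mul_ne_iff] at H
    refine ⟨qpow_ne_zero _ _, ?_, ?_, ?_⟩
    · rw [e1]; exact H _ (by omega) (by omega)
    · rw [e2]; exact H _ (by omega) (by omega)
    · rw [e3]; exact mul_ne_zero (pow_ne_zero _ hs) (H _ (by omega) (by omega))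

theorem forall_reg_iff (h μ : ℂ) (N : ℕ) :
    (∀ j ≤ N, Reg (qpow h (1 / 2)) (qpow h (μ - (j : ℕ)))) ↔
      ∀ l : ℤ, -1 ≤ l → l ≤ 2 * N + 1 → qpow h (2 * μ) ≠ -qpow h l := by
  simp only [reg_qpow_iff]
  constructor
  · intro H l h1 h2
    rcases lt_or_ge l 0 with hl | hl
    · exact H 0 (by omega) l (by omega) (by omega)
    · exact H (l / 2).toNat (by omega) l (by omega) (by omega)
  · intro H j hj l h1 h2
    exact H l (by omega) (by omega)

theorem Generic.qpow_nat_ne (G : Generic h) {n : ℕ} (hn : 0 < n) : qpow h n ≠ 1 := by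
  have := G n hn
  rwa [← qpow_one, ← qpow_nat_mul, mul_one] at this

theorem Generic.Lam_ne_zero (G : Generic h) {μ : ℂ} {N k : ℕ}
    (hreg : ∀ l : ℤ, -1 ≤ l → l ≤ 2 * N + 1 → qpow h (2 * μ) ≠ -qpow h l) (hk : 1 ≤ k)
    (hkN : k ≤ N + 1) : Lam h μ k ≠ Lam h μ 0 := by
  intro e
  rcases G.Lam_inj e with e | e
  · rw [sub_zero] at e
    exact G.qpow_nat_ne (by omega) e
  · have := (qpow_two_mul_ne_iff h μ _).1 (hreg (k - 1) (by omega) (by omega))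
    apply this
    have e' : 2 * μ - ((k - 1 : ℤ) : ℂ) = 2 * μ + 1 - k - 0 := by push_cast; ring
    rw [e', e]; ring

theorem D_zero (h μ j₁ j₂ j₃ : ℂ) : D h μ j₁ j₂ j₃ 0 = 0 := by simp [D]

theorem Generic.D_succ (G : Generic h) {μ j₁ j₂ j₃ A₁ A₂ A₃ : ℂ}
    (M : Match (qpow h (1 / 2)) (sym₁ h μ j₁ j₂ j₃) (sym₂ h μ j₁ j₂ j₃) (sym₃ h μ j₁ j₂ j₃)
      (sym₄ h μ j₁ j₂ j₃) A₁ A₂ A₃) (j : ℕ) (r : Reg (qpow h (1 / 2)) (qpow h (μ - j))) :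
    D h μ j₁ j₂ j₃ (j + 1 : ℕ) = D h μ j₁ j₂ j₃ j +
      incr (qpow h (1 / 2)) A₁ A₂ A₃ (qpow h (μ - j)) := by
  have hs := qpow_ne_zero h (1 / 2)
  have e : qpow h (μ - (j + 1 : ℕ)) * qpow h (1 / 2) = qpow h (μ - j) / qpow h (1 / 2) := by
    rw [← qpow_add, ← qpow_sub]; congr 1; push_cast; ring
  rw [D_eq G, D_eq G, e, ← quartD_sub hs G.pow_four r M.h₃ M.mul M.sq]
  ring

theorem Generic.D_eq_zero_iff (G : Generic h) {μ j₁ j₂ j₃ : ℂ} {N k : ℕ}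
    (hreg : ∀ l : ℤ, -1 ≤ l → l ≤ 2 * N + 1 → qpow h (2 * μ) ≠ -qpow h l) (hk : 1 ≤ k)
    (hkN : k ≤ N + 1) : D h μ j₁ j₂ j₃ k = 0 ↔
      Lam h μ j₁ = Lam h μ k ∨ Lam h μ j₂ = Lam h μ k ∨ Lam h μ j₃ = Lam h μ k := by
  have hw := G.sub_ne
  have hk0 := G.add_ne
  have hL := sub_ne_zero.2 (G.Lam_ne_zero hreg hk hkN)
  -- The product `g_{k-1} g_k` is `den` at index `k - 1 ≤ N`, so regularity at `N + 1` is not needed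
  -- when `k = N + 1`.
  have hg : g h μ k ≠ 0 := by
    have r := (forall_reg_iff h μ N).2 hreg (k - 1) (by omega)
    have := r.den_ne (qpow_ne_zero _ _) G.pow_four
    rw [← g_mul_g G] at this
    have e : ((k - 1 : ℕ) : ℂ) + 1 = k := by
      rw [Nat.cast_sub hk]; push_cast; ring
    rw [e] at this
    exact right_ne_zero_of_mul this
  rw [D, qpow_neg]
  simp only [mul_eq_zero, div_eq_zero_iff, pow_eq_zero_iff (two_ne_zero),
    pow_eq_zero_iff (four_ne_zero), hw, hk0, hg, hL, qpow_ne_zero, false_or, or_false,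
    sub_eq_zero]
  rw [or_assoc, eq_comm, @eq_comm _ (Lam h μ k) (Lam h μ j₂), @eq_comm _ (Lam h μ k) (Lam h μ j₃)]

theorem exists_cubic_roots (a b c : ℂ) :
    ∃ x y z : ℂ, x + y + z = a ∧ x * y + x * z + y * z = b ∧ x * y * z = c := by
  obtain ⟨x, hx⟩ := IsAlgClosed.exists_eval₂_eq_zero (RingHom.id ℂ)
    (Polynomial.X ^ 3 - Polynomial.C a * Polynomial.X ^ 2 + Polynomial.C b * Polynomial.X
      - Polynomial.C c : Polynomial ℂ) (by
      have : (Polynomial.X ^ 3 - Polynomial.C a * Polynomial.X ^ 2 + Polynomial.C b * Polynomial.X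
        - Polynomial.C c : Polynomial ℂ).degree = 3 := by
        compute_degree!
      rw [this]; norm_num)
  have hx : x ^ 3 - a * x ^ 2 + b * x - c = 0 := by simpa using hx
  obtain ⟨y, hy⟩ := IsAlgClosed.exists_eval₂_eq_zero (RingHom.id ℂ)
    (Polynomial.X ^ 2 - Polynomial.C (a - x) * Polynomial.X
      + Polynomial.C (b - x * (a - x)) : Polynomial ℂ) (by
      have : (Polynomial.X ^ 2 - Polynomial.C (a - x) * Polynomial.X
        + Polynomial.C (b - x * (a - x)) : Polynomial ℂ).degree = 2 := by
        compute_degree!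
      rw [this]; norm_num)
  have hy : y ^ 2 - (a - x) * y + (b - x * (a - x)) = 0 := by simpa using hy
  exact ⟨x, y, a - x - y, by ring, by linear_combination -hy,
    by linear_combination hx - x * hy⟩

/-- `Match` gives three equations for four symmetric functions; requiring `Λ_0` to be a root
supplies the fourth. They can be solved because `Λ_0² + 4/w² ≠ 0` by regularity, and the other three
roots are values of `Λ` because `Λ` is surjective in `j`. -/
theorem Generic.exists_match (G : Generic h) (μ A₁ A₂ A₃ : ℂ)
    (r : Reg (qpow h (1 / 2)) (qpow h μ)) : ∃ j₁ j₂ j₃,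
    Match (qpow h (1 / 2)) (sym₁ h μ j₁ j₂ j₃) (sym₂ h μ j₁ j₂ j₃) (sym₃ h μ j₁ j₂ j₃)
      (sym₄ h μ j₁ j₂ j₃) A₁ A₂ A₃ := by
  have hw := G.sub_ne
  have hk := G.add_ne
  have hs := qpow_ne_zero h (1 / 2)
  have ht := qpow_ne_zero h μ
  have hx0 : Lam h μ 0 ^ 2 + 4 / (qpow h (1 / 2) - (qpow h (1 / 2))⁻¹) ^ 2 ≠ 0 := by
    have e : Lam h μ 0 ^ 2 + 4 / (qpow h (1 / 2) - (qpow h (1 / 2))⁻¹) ^ 2 =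
        ((qpow h μ ^ 2 * qpow h (1 / 2) ^ 2 + 1) /
          (qpow h μ * qpow h (1 / 2) * (qpow h (1 / 2) - (qpow h (1 / 2))⁻¹))) ^ 2 := by
      rw [Lam_eq G, sub_zero]
      generalize qpow h (1 / 2) - (qpow h (1 / 2))⁻¹ = w at *
      field_simp
      ring
    rw [e]
    exact pow_ne_zero _ (div_ne_zero r.up (mul_ne_zero (mul_ne_zero ht hs) hw))
  have hI := I_ne_zero
  simp only [sym₁, sym₂, sym₃, sym₄]
  generalize hx : Lam h μ 0 = x at *
  generalize hwd : qpow h (1 / 2) - (qpow h (1 / 2))⁻¹ = w at *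
  generalize hkd : qpow h (1 / 2) + (qpow h (1 / 2))⁻¹ = k at *
  obtain ⟨e₁, he₁⟩ : ∃ e, e = A₃ * k ^ 2 / I := ⟨_, rfl⟩
  obtain ⟨e₃, he₃⟩ : ∃ e, e = 4 / w ^ 2 * e₁ - A₁ * A₂ * k ^ 4 / (I * w) := ⟨_, rfl⟩
  obtain ⟨b, hb⟩ : ∃ b, b = (A₁ ^ 2 + A₂ ^ 2) * k ^ 4 / w ^ 2 := ⟨_, rfl⟩
  -- The equation for `e₄` in terms of `e₂`, inserted into the quartic at its root `x = Λ_0`, is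
  -- linear in `e₂`.
  obtain ⟨e₂, he₂⟩ : ∃ e, e = -(x ^ 4 - e₁ * x ^ 3 - e₃ * x + b - (4 / w ^ 2) ^ 2) /
    (x ^ 2 + 4 / w ^ 2) := ⟨_, rfl⟩
  rw [eq_div_iff hx0] at he₂
  -- The coefficients are those of the quartic divided by `X - x`.
  obtain ⟨x₁, x₂, x₃, c₁, c₂, c₃⟩ := exists_cubic_roots (e₁ - x) (e₂ - x * (e₁ - x))
    (e₃ - x * (e₂ - x * (e₁ - x)))
  obtain ⟨j₁, h₁⟩ := G.Lam_surjective μ x₁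
  obtain ⟨j₂, h₂⟩ := G.Lam_surjective μ x₂
  obtain ⟨j₃, h₃⟩ := G.Lam_surjective μ x₃
  refine ⟨j₁, j₂, j₃, ?_⟩
  rw [h₁, h₂, h₃]
  have s₁ : x + x₁ + x₂ + x₃ = e₁ := by linear_combination c₁
  have s₂ : x * x₁ + x * x₂ + x * x₃ + x₁ * x₂ + x₁ * x₃ + x₂ * x₃ = e₂ := by
    linear_combination x * c₁ + c₂
  have s₃ : x * x₁ * x₂ + x * x₁ * x₃ + x * x₂ * x₃ + x₁ * x₂ * x₃ = e₃ := by
    linear_combination x * c₂ + c₃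
  have s₄ : x * x₁ * x₂ * x₃ = b + 4 / w ^ 2 * e₂ - (4 / w ^ 2) ^ 2 := by
    linear_combination x * c₃ - he₂
  rw [s₁, s₂, s₃, s₄]
  constructor
  · rw [hkd, he₁]; field_simp
  · rw [hkd, hwd, he₃]; field_simp; ring
  · rw [hkd, hwd, hb]; field_simp; ring

end Dictionary

/-! ### Representations as triples of operators; classicality as regularity -/

section Representations

variable {h A₁ A₂ A₃ : ℂ} {V : Type*} [AddCommGroup V] [Module ℂ V]

theorem relations_of_rep (ρ : AW h A₁ A₂ A₃ →ₐ[ℂ] Module.End ℂ V) :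
    Relations (qpow h (1 / 2)) A₁ A₂ A₃ (ρ (I₁ h A₁ A₂ A₃)) (ρ (I₂ h A₁ A₂ A₃))
      (ρ (I₃ h A₁ A₂ A₃)) := by
  have key : ∀ {a b}, Rel h A₁ A₂ A₃ a b → ∀ v, ρ (RingQuot.mkAlgHom ℂ (Rel h A₁ A₂ A₃) a) v =
      ρ (RingQuot.mkAlgHom ℂ (Rel h A₁ A₂ A₃) b) v := fun hr v => by
    rw [RingQuot.mkAlgHom_rel ℂ hr]
  constructor
  · intro v
    simpa [I₁, I₂, I₃, qpow_neg, Algebra.smul_def] using key Rel.rel₁ v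
  · intro v
    simpa [I₁, I₂, I₃, qpow_neg, Algebra.smul_def] using key Rel.rel₂ v
  · intro v
    simpa [I₁, I₂, I₃, qpow_neg, Algebra.smul_def] using key Rel.rel₃ v

theorem exists_rep {X Y Z : Module.End ℂ V} (R : Relations (qpow h (1 / 2)) A₁ A₂ A₃ X Y Z) :
    ∃ σ : AW h A₁ A₂ A₃ →ₐ[ℂ] Module.End ℂ V,
      σ (I₁ h A₁ A₂ A₃) = X ∧ σ (I₂ h A₁ A₂ A₃) = Y ∧ σ (I₃ h A₁ A₂ A₃) = Z := by
  let f : FreeAlgebra ℂ (Fin 3) →ₐ[ℂ] Module.End ℂ V := FreeAlgebra.lift ℂ ![X, Y, Z]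
  have hf : ∀ ⦃a b⦄, Rel h A₁ A₂ A₃ a b → f a = f b := by
    intro a b hr
    ext v
    cases hr
    · simpa [f, qpow_neg, Algebra.smul_def] using R.xy v
    · simpa [f, qpow_neg, Algebra.smul_def] using R.yz v
    · simpa [f, qpow_neg, Algebra.smul_def] using R.zx v
  refine ⟨RingQuot.liftAlgHom ℂ ⟨f, hf⟩, ?_, ?_, ?_⟩ <;>
    simp [I₁, I₂, I₃, f, RingQuot.liftAlgHom_mkAlgHom_apply]

theorem invariant_of_generators (ρ : AW h A₁ A₂ A₃ →ₐ[ℂ] Module.End ℂ V) (U : Submodule ℂ V)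
    (h₁ : ∀ v ∈ U, ρ (I₁ h A₁ A₂ A₃) v ∈ U) (h₂ : ∀ v ∈ U, ρ (I₂ h A₁ A₂ A₃) v ∈ U)
    (h₃ : ∀ v ∈ U, ρ (I₃ h A₁ A₂ A₃) v ∈ U) (a : AW h A₁ A₂ A₃) : ∀ v ∈ U, ρ a v ∈ U := by
  obtain ⟨a, rfl⟩ := RingQuot.mkAlgHom_surjective ℂ (Rel h A₁ A₂ A₃) a
  induction a using FreeAlgebra.induction with
  | grade0 r =>
    intro v hv
    rw [AlgHom.commutes, AlgHom.commutes]
    exact U.smul_mem r hv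
  | grade1 x =>
    fin_cases x
    · exact h₁
    · exact h₂
    · exact h₃
  | mul a b ha hb =>
    intro v hv
    rw [map_mul, map_mul]
    exact ha _ (hb v hv)
  | add a b ha hb =>
    intro v hv
    rw [map_add, map_add]
    exact U.add_mem (ha v hv) (hb v hv)

/-- Irregular parameters satisfy `t = ±i`, `ts = ±i` or `t = ±is`. The first case gives the levels
`±2/(q - q⁻¹)`, the other two give `±1/(s - s⁻¹)`. -/
theorem IsClassical.reg (G : Generic h) {ρ : AW h A₁ A₂ A₃ →ₐ[ℂ] Module.End ℂ V}
    (hcl : IsClassical ρ) {t : ℂ} (ht : t ≠ 0)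
    (hev : (ρ (I₃ h A₁ A₂ A₃)).HasEigenvalue (lev (qpow h (1 / 2)) t)) :
    Reg (qpow h (1 / 2)) t := by
  have hs := qpow_ne_zero h (1 / 2)
  have h1 := sq_sub_one_ne G.pow_four
  have h2 := sq_add_one_ne G.pow_four
  have e1 : qpow h 1 - qpow h (-1) = (qpow h (1 / 2) ^ 2 - 1) * (qpow h (1 / 2) ^ 2 + 1) /
      qpow h (1 / 2) ^ 2 := by
    rw [qpow_neg, qpow_one]; field_simp; ring
  have e2 : qpow h (1 / 2) - qpow h (-(1 / 2)) = (qpow h (1 / 2) ^ 2 - 1) / qpow h (1 / 2) := by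
    rw [qpow_neg]; field_simp
  have hl : ∀ c, lev (qpow h (1 / 2)) t = c → ¬ (ρ (I₃ h A₁ A₂ A₃)).HasEigenvalue c → False :=
    fun c hc hn => hn (hc ▸ hev)
  have key : ∀ ε : ℂ, ε = 1 ∨ ε = -1 →
      lev (qpow h (1 / 2)) t ≠ 2 * ε / (qpow h 1 - qpow h (-1)) ∧
      lev (qpow h (1 / 2)) t ≠ ε / (qpow h (1 / 2) - qpow h (-(1 / 2))) := fun ε hε =>
    ⟨fun hc => hl _ hc (hcl ε hε).1, fun hc => hl _ hc (hcl ε hε).2⟩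
  rw [lev, qn_eq hs G.pow_four ht, e1, e2] at key
  generalize qpow h (1 / 2) = s at *
  refine ⟨ht, ?_, ?_, ?_⟩
  · intro e
    have ht2 : (t - I) * (t + I) = 0 := by linear_combination e - I_sq
    rcases mul_eq_zero.1 ht2 with e' | e'
    · refine (key 1 (Or.inl rfl)).1 ?_
      obtain rfl : t = I := by linear_combination e'
      field_simp
      linear_combination -I_sq
    · refine (key (-1) (Or.inr rfl)).1 ?_
      obtain rfl : t = -I := by linear_combination e'
      field_simp
      linear_combination I_sq
  · intro e
    have ht2 : (t * s - I) * (t * s + I) = 0 := by linear_combination e - I_sq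
    rcases mul_eq_zero.1 ht2 with e' | e'
    · refine (key 1 (Or.inl rfl)).2 ?_
      obtain rfl : t = I / s := by field_simp; linear_combination e'
      field_simp
      rw [I_sq]; ring
    · refine (key (-1) (Or.inr rfl)).2 ?_
      obtain rfl : t = -I / s := by field_simp; linear_combination e'
      field_simp
      rw [I_sq]; ring
  · intro e
    have ht2 : (t - I * s) * (t + I * s) = 0 := by linear_combination e - s ^ 2 * I_sq
    rcases mul_eq_zero.1 ht2 with e' | e'
    · refine (key 1 (Or.inl rfl)).2 ?_
      obtain rfl : t = I * s := by linear_combination e'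
      field_simp
      rw [I_sq]; ring
    · refine (key (-1) (Or.inr rfl)).2 ?_
      obtain rfl : t = -I * s := by linear_combination e'
      field_simp
      rw [I_sq]; ring

end Representations

/-! ### Invariant tails of a chain -/

section Chains

variable {V : Type*} [AddCommGroup V] [Module ℂ V]
variable {s t A₁ A₂ A₃ : ℂ} {X Y Z : Module.End ℂ V} {v : ℕ → V} {d : ℕ → ℂ} {n : ℕ}

theorem IsChain.X_apply (C : IsChain s A₁ A₂ A₃ t X Y Z v d n) (hs : s ≠ 0) {j : ℕ} (hj : j < n) :
    X (v j) = (-s⁻¹ / (t * (s ^ 2)⁻¹ ^ j + (t * (s ^ 2)⁻¹ ^ j)⁻¹)) • (d j • v (j - 1) + v (j + 1))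
      - diag₁ s A₁ A₂ (t * (s ^ 2)⁻¹ ^ j) • v j := by
  have r := C.reg j hj
  rw [X_eq (A₁ := A₁) (A₂ := A₂) (X := X) (Y := Y) hs r.ne r.mid, C.up j hj, C.down]

theorem IsChain.Y_apply (C : IsChain s A₁ A₂ A₃ t X Y Z v d n) {j : ℕ} (hj : j < n) :
    Y (v j) = (I / (t * (s ^ 2)⁻¹ ^ j + (t * (s ^ 2)⁻¹ ^ j)⁻¹)) •
      ((t * (s ^ 2)⁻¹ ^ j) • d j • v (j - 1) - (t * (s ^ 2)⁻¹ ^ j)⁻¹ • v (j + 1))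
      - diag₂ s A₁ A₂ (t * (s ^ 2)⁻¹ ^ j) • v j := by
  have r := C.reg j hj
  rw [Y_eq (s := s) (A₁ := A₁) (A₂ := A₂) (X := X) (Y := Y) r.ne r.mid, C.up j hj, C.down]

theorem IsChain.invariant (C : IsChain s A₁ A₂ A₃ t X Y Z v d n) (hs : s ≠ 0) {m : ℕ}
    (hm : d m = 0) {x : V} (hx : x ∈ Submodule.span ℂ (v '' Set.Ico m n)) :
    X x ∈ Submodule.span ℂ (v '' Set.Ico m n) ∧ Y x ∈ Submodule.span ℂ (v '' Set.Ico m n) ∧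
      Z x ∈ Submodule.span ℂ (v '' Set.Ico m n) := by
  have mem : ∀ j, m ≤ j → j < n → v j ∈ Submodule.span ℂ (v '' Set.Ico m n) := fun j h1 h2 =>
    Submodule.subset_span ⟨j, ⟨h1, h2⟩, rfl⟩
  induction hx using Submodule.span_induction with
  | mem x hx =>
    obtain ⟨j, ⟨h1, h2⟩, rfl⟩ := hx
    have hd : d j • v (j - 1) ∈ Submodule.span ℂ (v '' Set.Ico m n) := by
      -- Only raising from index `m` could leave the tail, and there the coefficient `d m` vanishes.
      rcases h1.eq_or_lt with rfl | h1
      · rw [hm, zero_smul]; exact Submodule.zero_mem _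
      · exact Submodule.smul_mem _ _ (mem _ (by omega) (by omega))
    have hn : v (j + 1) ∈ Submodule.span ℂ (v '' Set.Ico m n) := by
      rcases Nat.lt_or_ge (j + 1) n with h3 | h3
      · exact mem _ (by omega) h3
      · have : j + 1 = n := by omega
        rw [this, C.last]
        exact Submodule.zero_mem _
    refine ⟨?_, ?_, ?_⟩
    · rw [C.X_apply hs h2]
      exact Submodule.sub_mem _ (Submodule.smul_mem _ _ (Submodule.add_mem _ hd hn))
        (Submodule.smul_mem _ _ (mem j h1 h2))
    · rw [C.Y_apply h2]
      exact Submodule.sub_mem _ (Submodule.smul_mem _ _ (Submodule.sub_mem _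
        (Submodule.smul_mem _ _ hd) (Submodule.smul_mem _ _ hn)))
        (Submodule.smul_mem _ _ (mem j h1 h2))
    · rw [C.eigen j h2]
      exact Submodule.smul_mem _ _ (mem j h1 h2)
  | zero => simp
  | add x y _ _ hx hy =>
    simp only [map_add]
    exact ⟨Submodule.add_mem _ hx.1 hy.1, Submodule.add_mem _ hx.2.1 hy.2.1,
      Submodule.add_mem _ hx.2.2 hy.2.2⟩
  | smul c x _ hx =>
    simp only [map_smul]
    exact ⟨Submodule.smul_mem _ _ hx.1, Submodule.smul_mem _ _ hx.2.1,
      Submodule.smul_mem _ _ hx.2.2⟩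

theorem IsChain.linearIndependent (C : IsChain s A₁ A₂ A₃ t X Y Z v d n) (hs : s ≠ 0)
    (ht : t ≠ 0) (hroot : ∀ n : ℕ, 0 < n → (s ^ 2) ^ n ≠ 1) :
    LinearIndependent ℂ (fun j : Fin n => v j) := by
  refine Module.End.eigenvectors_linearIndependent' Z
    (fun j : Fin n => lev s (t * (s ^ 2)⁻¹ ^ (j : ℕ))) (fun k l hkl => ?_) _ (fun j => ?_)
  · exact Fin.ext (lev_chain_injOn hs hroot ht (Or.inr rfl) k.2 l.2 C.reg hkl)
  · rw [Module.End.hasEigenvector_iff, Module.End.mem_eigenspace_iff]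
    exact ⟨C.eigen j j.2, C.ne j j.2⟩

theorem IsChain.span_eq_top (C : IsChain s A₁ A₂ A₃ t X Y Z v d n) (hs : s ≠ 0)
    (hirr : ∀ U : Submodule ℂ V, (∀ x ∈ U, X x ∈ U ∧ Y x ∈ U ∧ Z x ∈ U) → U = ⊥ ∨ U = ⊤) {m : ℕ}
    (hm : d m = 0) (hmn : m < n) : Submodule.span ℂ (v '' Set.Ico m n) = ⊤ := by
  refine (hirr _ fun x hx => C.invariant hs hm hx).resolve_left fun h => C.ne m hmn ?_
  have : v m ∈ Submodule.span ℂ (v '' Set.Ico m n) :=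
    Submodule.subset_span ⟨m, ⟨le_rfl, hmn⟩, rfl⟩
  rwa [h, Submodule.mem_bot] at this

/-- If `d m = 0`, the invariant tail starting at `m` is the whole space, yet `v 0` is independent of
it. -/
theorem IsChain.d_ne (C : IsChain s A₁ A₂ A₃ t X Y Z v d n) (hs : s ≠ 0)
    (ht : t ≠ 0) (hroot : ∀ n : ℕ, 0 < n → (s ^ 2) ^ n ≠ 1)
    (hirr : ∀ U : Submodule ℂ V, (∀ x ∈ U, X x ∈ U ∧ Y x ∈ U ∧ Z x ∈ U) → U = ⊥ ∨ U = ⊤) {m : ℕ}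
    (hm : 1 ≤ m) (hmn : m < n) : d m ≠ 0 := by
  intro h
  have hli := C.linearIndependent hs ht hroot
  have htop := C.span_eq_top hs hirr h hmn
  have hnot := hli.notMem_span_image (s := {j : Fin n | m ≤ j}) (x := ⟨0, by omega⟩)
    (by simp; omega)
  have himg : (fun j : Fin n => v j) '' {j : Fin n | m ≤ j} = v '' Set.Ico m n := by
    ext x
    constructor
    · rintro ⟨j, hj, rfl⟩
      exact ⟨j, ⟨hj, j.2⟩, rfl⟩
    · rintro ⟨j, ⟨h1, h2⟩, rfl⟩
      exact ⟨⟨j, h2⟩, h1, rfl⟩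
  rw [himg, htop] at hnot
  exact hnot Submodule.mem_top

end Chains

/-! ### Action of the model matrices on basis vectors -/

section Model

/-- The basis vector `v_k` of the model; it is zero for `k > N`. -/
def vec (N k : ℕ) : Fin (N + 1) → ℂ := fun i => if (i : ℕ) = k then 1 else 0

theorem vec_eq_single {N : ℕ} (j : Fin (N + 1)) : vec N j = Pi.single j 1 := by
  ext i
  simp [vec, Pi.single_apply, Fin.ext_iff]

theorem vec_eq_zero {N k : ℕ} (hk : N < k) : vec N k = 0 := by
  ext i
  have : (i : ℕ) ≠ k := by omega
  simp [vec, this]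

theorem linearMap_ext_vec {N : ℕ} {W : Type*} [AddCommGroup W] [Module ℂ W]
    {f f' : (Fin (N + 1) → ℂ) →ₗ[ℂ] W} (H : ∀ k ≤ N, f (vec N k) = f' (vec N k)) : f = f' := by
  refine (Pi.basisFun ℂ (Fin (N + 1))).ext fun j => ?_
  rw [Pi.basisFun_apply, ← vec_eq_single]
  exact H j (by omega)

theorem commutation_ext_vec {N : ℕ} {P Q S : Module.End ℂ (Fin (N + 1) → ℂ)} {a b c : ℂ}
    (H : ∀ k ≤ N, a • P (Q (vec N k)) - b • Q (P (vec N k)) = S (vec N k) + c • vec N k)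
    (v : Fin (N + 1) → ℂ) : a • P (Q v) - b • Q (P v) = S v + c • v :=
  LinearMap.congr_fun (f := a • (P ∘ₗ Q) - b • (Q ∘ₗ P)) (g := S + c • LinearMap.id)
    (linearMap_ext_vec H) v

theorem toLin'_vec {N k : ℕ} (hk : k ≤ N) (M : Matrix (Fin (N + 1)) (Fin (N + 1)) ℂ) :
    Matrix.toLin' M (vec N k) = fun i => M i ⟨k, by omega⟩ := by
  have : vec N k = Pi.single (⟨k, by omega⟩ : Fin (N + 1)) 1 := vec_eq_single ⟨k, by omega⟩
  rw [this, Matrix.toLin'_apply, Matrix.mulVec_single_one]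
  rfl

/-- For `k = 0` the truncated index `k - 1` is 0, so `up 0 = 0` must suppress that term. -/
theorem tridiag_vec {N k : ℕ} (hk : k ≤ N) {up diag down : ℕ → ℂ} (h0 : up 0 = 0) :
    Matrix.toLin' (tridiag N up diag down) (vec N k) =
      up k • vec N (k - 1) + diag k • vec N k + down k • vec N (k + 1) := by
  rw [toLin'_vec hk]
  ext i
  simp only [tridiag, Matrix.of_apply, Fin.ext_iff, Pi.add_apply, Pi.smul_apply, vec, smul_eq_mul]
  rcases Nat.eq_zero_or_pos k with rfl | hpos
  · rw [h0]
    split_ifs <;> first | omega | contradiction | simp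
  · split_ifs <;> first | omega | simp

variable {h μ j₁ j₂ j₃ A₁ A₂ A₃ : ℂ} {N : ℕ}

theorem M₁_vec (G : Generic h) {k : ℕ} (hk : k ≤ N) :
    Matrix.toLin' (M₁ h N A₁ A₂ μ j₁ j₂ j₃) (vec N k) =
      (-(qpow h (1 / 2))⁻¹ / (qpow h (μ - k) + (qpow h (μ - k))⁻¹)) •
        (D h μ j₁ j₂ j₃ k • vec N (k - 1) + vec N (k + 1))
      - diag₁ (qpow h (1 / 2)) A₁ A₂ (qpow h (μ - k)) • vec N k := by
  rw [M₁, tridiag_vec hk (by simp [D_zero])]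
  have e : -μ + k = -(μ - k) := by ring
  rw [e, qpow_neg, qpow_neg, g_mul_g G, qnum_eq, diag₁, lev, add_comm (qpow h (μ - k))⁻¹]
  match_scalars <;> ring

theorem M₂_vec (G : Generic h) {k : ℕ} (hk : k ≤ N) :
    Matrix.toLin' (M₂ h N A₁ A₂ μ j₁ j₂ j₃) (vec N k) =
      (I / (qpow h (μ - k) + (qpow h (μ - k))⁻¹)) •
        (qpow h (μ - k) • D h μ j₁ j₂ j₃ k • vec N (k - 1) -
          (qpow h (μ - k))⁻¹ • vec N (k + 1))
      - diag₂ (qpow h (1 / 2)) A₁ A₂ (qpow h (μ - k)) • vec N k := by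
  rw [M₂, tridiag_vec hk (by simp [D_zero])]
  have e : -μ + k = -(μ - k) := by ring
  rw [e, qpow_neg, qpow_neg, g_mul_g G, qnum_eq, diag₂, lev, add_comm (qpow h (μ - k))⁻¹]
  match_scalars <;> ring

theorem M₃_vec (h μ : ℂ) (N k : ℕ) :
    Matrix.toLin' (M₃ h N μ) (vec N k) = lev (qpow h (1 / 2)) (qpow h (μ - k)) • vec N k := by
  rcases Nat.lt_or_ge N k with hk | hk
  · rw [vec_eq_zero hk, map_zero, smul_zero]
  · rw [toLin'_vec hk]
    ext i
    by_cases hi : (i : ℕ) = k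
    · subst hi
      simp [M₃, vec, lev, qnum_eq]
    · have : i ≠ ⟨k, by omega⟩ := fun e => hi (congrArg Fin.val e)
      simp [M₃, vec, hi, this]

end Model

/-! ### Relations read off from a three-term action -/

section Ladder

variable {V : Type*} [AddCommGroup V] [Module ℂ V]
variable {s t A₁ A₂ A₃ : ℂ} {X Y Z : Module.End ℂ V}

theorem raise_eq_of (hs : s ≠ 0) (ht : t ≠ 0) (hT : t ^ 2 + 1 ≠ 0) {v u w : V}
    (hX : X v = (-s⁻¹ / (t + t⁻¹)) • (u + w) - diag₁ s A₁ A₂ t • v)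
    (hY : Y v = (I / (t + t⁻¹)) • (t • u - t⁻¹ • w) - diag₂ s A₁ A₂ t • v) :
    raise s A₁ A₂ t X Y v = u := by
  have hT' : t + t⁻¹ = (t ^ 2 + 1) / t := by field_simp
  rw [raise_apply, hX, hY, hT']
  match_scalars <;> field_simp <;> ring_nf <;> simp only [I_sq] <;> ring

theorem lower_eq_of (hs : s ≠ 0) (ht : t ≠ 0) (hT : t ^ 2 + 1 ≠ 0) {v u w : V}
    (hX : X v = (-s⁻¹ / (t + t⁻¹)) • (u + w) - diag₁ s A₁ A₂ t • v)
    (hY : Y v = (I / (t + t⁻¹)) • (t • u - t⁻¹ • w) - diag₂ s A₁ A₂ t • v) :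
    lower s A₁ A₂ t X Y v = w := by
  have hT' : t + t⁻¹ = (t ^ 2 + 1) / t := by field_simp
  rw [lower_apply, hX, hY, hT']
  match_scalars <;> field_simp <;> ring_nf <;> simp only [I_sq] <;> ring

theorem yz_apply (hs : s ≠ 0) (h4 : s ^ 4 ≠ 1) (r : Reg s t) {v u w : V}
    (hX : X v = (-s⁻¹ / (t + t⁻¹)) • (u + w) - diag₁ s A₁ A₂ t • v)
    (hY : Y v = (I / (t + t⁻¹)) • (t • u - t⁻¹ • w) - diag₂ s A₁ A₂ t • v)
    (hv : Z v = lev s t • v) (hu : Z u = lev s (t * s ^ 2) • u)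
    (hw : Z w = lev s (t / s ^ 2) • w) :
    s • Y (Z v) - s⁻¹ • Z (Y v) = X v + A₁ • v := by
  have h1 := diag₁_eq A₁ A₂ (r.den_ne hs h4)
  have e1 := lev_up hs h4 r.ne
  have e2 := lev_down hs h4 r.ne
  have ht := r.ne
  have hT := r.mid
  have hT' : t + t⁻¹ = (t ^ 2 + 1) / t := by field_simp
  rw [hv, map_smul, hX, hY, map_sub, map_smul, map_smul, map_sub, map_smul, map_smul, hv, hu, hw,
    h1, e1, e2, hT']
  generalize diag₂ s A₁ A₂ t = b₂ at *
  match_scalars <;> field_simp <;> ring_nf <;> simp only [I_sq] <;> ring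

theorem zx_apply (hs : s ≠ 0) (h4 : s ^ 4 ≠ 1) (r : Reg s t) {v u w : V}
    (hX : X v = (-s⁻¹ / (t + t⁻¹)) • (u + w) - diag₁ s A₁ A₂ t • v)
    (hY : Y v = (I / (t + t⁻¹)) • (t • u - t⁻¹ • w) - diag₂ s A₁ A₂ t • v)
    (hv : Z v = lev s t • v) (hu : Z u = lev s (t * s ^ 2) • u)
    (hw : Z w = lev s (t / s ^ 2) • w) :
    s • Z (X v) - s⁻¹ • X (Z v) = Y v + A₂ • v := by
  have h1 := diag₂_eq A₁ A₂ (r.den_ne hs h4)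
  have e1 := lev_up' hs h4 r.ne
  have e2 := lev_down' hs h4 r.ne
  have ht := r.ne
  have hT := r.mid
  have hT' : t + t⁻¹ = (t ^ 2 + 1) / t := by field_simp
  rw [hv, map_smul, hX, hY, map_sub, map_smul, map_smul, map_add, hv, hu, hw,
    h1, e1, e2, hT']
  generalize diag₁ s A₁ A₂ t = b₁ at *
  match_scalars <;> field_simp <;> ring

end Ladder

/-! ### The model: defining relations and irreducibility -/

section ModelRepresentation

variable {h μ j₁ j₂ j₃ A₁ A₂ A₃ : ℂ} {N : ℕ}

theorem qpow_sub_succ (h μ : ℂ) (k : ℕ) :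
    qpow h (μ - (k + 1 : ℕ)) = qpow h (μ - k) / qpow h (1 / 2) ^ 2 := by
  rw [← qpow_one, ← qpow_sub]; congr 1; push_cast; ring

theorem qpow_sub_succ_mul (h μ : ℂ) (k : ℕ) :
    qpow h (μ - (k + 1 : ℕ)) * qpow h (1 / 2) ^ 2 = qpow h (μ - k) := by
  rw [← qpow_one, ← qpow_add]; congr 1; push_cast; ring

theorem model_raise (G : Generic h) {k : ℕ} (hk : k ≤ N)
    (r : Reg (qpow h (1 / 2)) (qpow h (μ - k))) :
    raise (qpow h (1 / 2)) A₁ A₂ (qpow h (μ - k)) (Matrix.toLin' (M₁ h N A₁ A₂ μ j₁ j₂ j₃))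
      (Matrix.toLin' (M₂ h N A₁ A₂ μ j₁ j₂ j₃)) (vec N k) =
      D h μ j₁ j₂ j₃ k • vec N (k - 1) :=
  raise_eq_of (qpow_ne_zero _ _) r.ne r.mid (M₁_vec G hk) (M₂_vec G hk)

theorem model_lower (G : Generic h) {k : ℕ} (hk : k ≤ N)
    (r : Reg (qpow h (1 / 2)) (qpow h (μ - k))) :
    lower (qpow h (1 / 2)) A₁ A₂ (qpow h (μ - k)) (Matrix.toLin' (M₁ h N A₁ A₂ μ j₁ j₂ j₃))
      (Matrix.toLin' (M₂ h N A₁ A₂ μ j₁ j₂ j₃)) (vec N k) = vec N (k + 1) :=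
  lower_eq_of (qpow_ne_zero _ _) r.ne r.mid (M₁_vec G hk) (M₂_vec G hk)

/-- The second and third relations use only the eigenvalues of `I₃`. The first reduces to the
recursion `Generic.D_succ`, and at the last basis vector to the vanishing of `D̃_{N+1}`. -/
theorem Generic.model_relations (G : Generic h)
    (hreg : ∀ j ≤ N, Reg (qpow h (1 / 2)) (qpow h (μ - (j : ℕ))))
    (M : Match (qpow h (1 / 2)) (sym₁ h μ j₁ j₂ j₃) (sym₂ h μ j₁ j₂ j₃) (sym₃ h μ j₁ j₂ j₃)
      (sym₄ h μ j₁ j₂ j₃) A₁ A₂ A₃) (hD : D h μ j₁ j₂ j₃ (N + 1 : ℕ) = 0) :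
    Relations (qpow h (1 / 2)) A₁ A₂ A₃ (Matrix.toLin' (M₁ h N A₁ A₂ μ j₁ j₂ j₃))
      (Matrix.toLin' (M₂ h N A₁ A₂ μ j₁ j₂ j₃)) (Matrix.toLin' (M₃ h N μ)) := by
  have hs := qpow_ne_zero h (1 / 2)
  have h4 := G.pow_four
  have hup : ∀ k, Matrix.toLin' (M₃ h N μ) (D h μ j₁ j₂ j₃ (k : ℕ) • vec N (k - 1)) =
      lev (qpow h (1 / 2)) (qpow h (μ - k) * qpow h (1 / 2) ^ 2) •
        (D h μ j₁ j₂ j₃ k • vec N (k - 1)) := by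
    intro k
    cases k with
    | zero => simp [D_zero]
    | succ k =>
      rw [map_smul, Nat.add_sub_cancel, M₃_vec, smul_comm, qpow_sub_succ_mul]
  have hdown : ∀ k, Matrix.toLin' (M₃ h N μ) (vec N (k + 1)) =
      lev (qpow h (1 / 2)) (qpow h (μ - k) / qpow h (1 / 2) ^ 2) • vec N (k + 1) := by
    intro k
    rw [M₃_vec, qpow_sub_succ]
  constructor
  · refine commutation_ext_vec fun k hk => ?_
    have r := hreg k hk
    have key := xy_apply hs h4 r (M₁_vec (j₁ := j₁) (j₂ := j₂) (j₃ := j₃) (A₁ := A₁) (A₂ := A₂)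
      G hk) (M₂_vec G hk) (by
        cases k with
        | zero => exact Or.inl (by simp [D_zero])
        | succ k =>
          right
          rw [qpow_sub_succ_mul]
          exact ⟨hreg k (by omega), model_lower G (by omega) (hreg k (by omega))⟩) (by
        rw [← qpow_sub_succ]
        rcases Nat.lt_or_ge k N with h1 | h1
        · exact Or.inr (hreg _ h1)
        · exact Or.inl (vec_eq_zero (by omega)))
    have hr : raise (qpow h (1 / 2)) A₁ A₂ (qpow h (μ - k) / qpow h (1 / 2) ^ 2)
        (Matrix.toLin' (M₁ h N A₁ A₂ μ j₁ j₂ j₃)) (Matrix.toLin' (M₂ h N A₁ A₂ μ j₁ j₂ j₃))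
        (vec N (k + 1)) = D h μ j₁ j₂ j₃ (k + 1 : ℕ) • vec N k := by
      rcases Nat.lt_or_ge k N with h1 | h1
      · rw [← qpow_sub_succ, model_raise G h1 (hreg _ h1)]
        rfl
      · obtain rfl : k = N := by omega
        rw [vec_eq_zero (by omega), map_zero, hD, zero_smul]
    rw [hr, G.D_succ M k r, incr] at key
    rw [key, M₃_vec]
    have ht := r.ne
    have hT : qpow h (μ - k) + (qpow h (μ - k))⁻¹ ≠ 0 := by
      have : qpow h (μ - k) + (qpow h (μ - k))⁻¹ = (qpow h (μ - k) ^ 2 + 1) / qpow h (μ - k) := by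
        field_simp
      rw [this]
      exact div_ne_zero r.mid ht
    generalize qpow h (μ - k) + (qpow h (μ - k))⁻¹ = T at *
    match_scalars
    field_simp
    ring_nf
    simp only [I_sq]
    ring
  · refine commutation_ext_vec fun k hk => ?_
    exact yz_apply hs h4 (hreg k hk) (M₁_vec G hk) (M₂_vec G hk) (M₃_vec ..) (hup k) (hdown k)
  · refine commutation_ext_vec fun k hk => ?_
    exact zx_apply hs h4 (hreg k hk) (M₁_vec G hk) (M₂_vec G hk) (M₃_vec ..) (hup k) (hdown k)

theorem raise_mem {V : Type*} [AddCommGroup V] [Module ℂ V] {s t : ℂ} {X Y : Module.End ℂ V}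
    {U : Submodule ℂ V} (hX : ∀ v ∈ U, X v ∈ U) (hY : ∀ v ∈ U, Y v ∈ U) {v : V} (hv : v ∈ U) :
    raise s A₁ A₂ t X Y v ∈ U := by
  rw [raise_apply]
  exact U.neg_mem (U.add_mem (U.smul_mem _ (U.add_mem (hX v hv) (U.smul_mem _ hv)))
    (U.smul_mem _ (U.add_mem (hY v hv) (U.smul_mem _ hv))))

theorem lower_mem {V : Type*} [AddCommGroup V] [Module ℂ V] {s t : ℂ} {X Y : Module.End ℂ V}
    {U : Submodule ℂ V} (hX : ∀ v ∈ U, X v ∈ U) (hY : ∀ v ∈ U, Y v ∈ U) {v : V} (hv : v ∈ U) :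
    lower s A₁ A₂ t X Y v ∈ U := by
  rw [lower_apply]
  exact U.neg_mem (U.sub_mem (U.smul_mem _ (U.add_mem (hX v hv) (U.smul_mem _ hv)))
    (U.smul_mem _ (U.add_mem (hY v hv) (U.smul_mem _ hv))))

/-- `I₃` has an eigenvector in `U`; as its eigenvalues on the basis are distinct, this is a multiple
of a basis vector. -/
theorem exists_vec_mem (G : Generic h)
    (hreg : ∀ j ≤ N, Reg (qpow h (1 / 2)) (qpow h (μ - (j : ℕ))))
    {U : Submodule ℂ (Fin (N + 1) → ℂ)} (hU : U ≠ ⊥)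
    (hZ : ∀ v ∈ U, Matrix.toLin' (M₃ h N μ) v ∈ U) : ∃ k ≤ N, vec N k ∈ U := by
  have hs := qpow_ne_zero h (1 / 2)
  have : Nontrivial U := Submodule.nontrivial_iff_ne_bot.2 hU
  obtain ⟨c, hc⟩ := Module.End.exists_eigenvalue ((Matrix.toLin' (M₃ h N μ)).restrict hZ)
  obtain ⟨u, hu⟩ := hc.exists_hasEigenvector
  have hu1 : Matrix.toLin' (M₃ h N μ) u = c • (u : Fin (N + 1) → ℂ) :=
    congrArg Subtype.val hu.apply_eq_smul
  have hu0 : (u : Fin (N + 1) → ℂ) ≠ 0 := fun e => hu.2 (Subtype.ext e)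
  obtain ⟨i, hi⟩ := Function.ne_iff.1 hu0
  have hi : (u : Fin (N + 1) → ℂ) i ≠ 0 := hi
  have hcoord : ∀ k : Fin (N + 1), lev (qpow h (1 / 2)) (qpow h (μ - (k : ℕ))) * u.1 k =
      c * u.1 k := by
    intro k
    have := congrFun hu1 k
    rw [Matrix.toLin'_apply, M₃, Matrix.mulVec_diagonal, qnum_eq] at this
    exact this
  have hci := mul_right_cancel₀ hi (hcoord i)
  have hzero : ∀ k : Fin (N + 1), k ≠ i → u.1 k = 0 := by
    intro k hk
    by_contra hne
    have hck := mul_right_cancel₀ hne (hcoord k)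
    refine hk (Fin.ext ?_)
    have e := hck.trans hci.symm
    rw [qpow_sub_nat, qpow_sub_nat] at e
    exact lev_chain_injOn hs G (qpow_ne_zero h μ) (Or.inr rfl) k.2 i.2
      (fun m hm => by rw [← qpow_sub_nat]; exact hreg m (by omega)) e
  refine ⟨i, by omega, ?_⟩
  have : vec N i = (u.1 i)⁻¹ • u.1 := by
    ext k
    by_cases hk : k = i
    · subst hk
      simp [vec, hi]
    · have hk' : (k : ℕ) ≠ i := fun e => hk (Fin.ext e)
      simp [vec, hk', hzero k hk]
  rw [this]
  exact U.smul_mem _ u.2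

/-- From one basis vector in `U`, nonzero `D̃_k` allow raising to `vec N 0`, from which lowering
reaches every other. -/
theorem Generic.model_irreducible (G : Generic h)
    (hreg : ∀ j ≤ N, Reg (qpow h (1 / 2)) (qpow h (μ - (j : ℕ))))
    (hD : ∀ k : ℕ, 1 ≤ k → k ≤ N → D h μ j₁ j₂ j₃ k ≠ 0)
    {U : Submodule ℂ (Fin (N + 1) → ℂ)} (hU : U ≠ ⊥)
    (hX : ∀ v ∈ U, Matrix.toLin' (M₁ h N A₁ A₂ μ j₁ j₂ j₃) v ∈ U)
    (hY : ∀ v ∈ U, Matrix.toLin' (M₂ h N A₁ A₂ μ j₁ j₂ j₃) v ∈ U)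
    (hZ : ∀ v ∈ U, Matrix.toLin' (M₃ h N μ) v ∈ U) : U = ⊤ := by
  obtain ⟨i, hi, hmem⟩ := exists_vec_mem G hreg hU hZ
  have hdesc : ∀ k, k ≤ N → vec N k ∈ U → vec N 0 ∈ U := by
    intro k
    induction k with
    | zero => exact fun _ h => h
    | succ k ih =>
      intro hk hm
      refine ih (by omega) ?_
      have := raise_mem (A₁ := A₁) (A₂ := A₂) (s := qpow h (1 / 2))
        (t := qpow h (μ - (k + 1 : ℕ))) hX hY hm
      rw [model_raise G hk (hreg _ hk), Nat.add_sub_cancel] at this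
      exact (U.smul_mem_iff (hD _ (by omega) hk)).1 this
  have hall : ∀ k, k ≤ N → vec N k ∈ U := by
    intro k
    induction k with
    | zero => exact fun _ => hdesc i hi hmem
    | succ k ih =>
      intro hk
      have := lower_mem (A₁ := A₁) (A₂ := A₂) (s := qpow h (1 / 2))
        (t := qpow h (μ - k)) hX hY (ih (by omega))
      rwa [model_lower G (by omega) (hreg _ (by omega))] at this
  rw [eq_top_iff, ← (Pi.basisFun ℂ (Fin (N + 1))).span_eq, Submodule.span_le]
  rintro _ ⟨j, rfl⟩
  rw [Pi.basisFun_apply, ← vec_eq_single]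
  exact hall j (by omega)

end ModelRepresentation

/-! ### The two directions of the classification -/

section Main

theorem Generic.exists_model (G : Generic h) {μ j₁ j₂ j₃ B₁ B₂ : ℂ} {N : ℕ}
    (hadm : Admissible h N μ j₁ j₂ j₃) (hB : (B₁, B₂) ∈ parPairs h μ j₁ j₂ j₃) :
    ∃ σ : AW h B₁ B₂ (parA₃ h μ j₁ j₂ j₃) →ₐ[ℂ] Module.End ℂ (Fin (N + 1) → ℂ),
      IsModel N μ j₁ j₂ j₃ σ ∧ IsIrreducible σ := by
  obtain ⟨ha, hb, hc⟩ := hadm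
  have hreg := (forall_reg_iff h μ N).2 ha
  have R := G.model_relations hreg (G.match_of_mem hB)
    ((G.D_eq_zero_iff ha (k := N + 1) (by omega) le_rfl).2 (by push_cast; exact hb))
  obtain ⟨σ, h₁, h₂, h₃⟩ := exists_rep R
  refine ⟨σ, ⟨h₁, h₂, h₃⟩, inferInstance, fun U hU => ?_⟩
  by_cases hbot : U = ⊥
  · exact Or.inl hbot
  · refine Or.inr (G.model_irreducible hreg (A₁ := B₁) (A₂ := B₂) (j₁ := j₁) (j₂ := j₂) (j₃ := j₃)
      ?_ hbot ?_ ?_ ?_)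
    · intro k h1 h2 hk
      rw [G.D_eq_zero_iff ha h1 (by omega)] at hk
      obtain ⟨c₁, c₂, c₃⟩ := hc k h1 h2
      tauto
    · rw [← h₁]; exact hU _
    · rw [← h₂]; exact hU _
    · rw [← h₃]; exact hU _

theorem Generic.exists_equivalent (G : Generic h) {A₁ A₂ A₃ : ℂ} {N : ℕ} {V : Type*}
    [AddCommGroup V] [Module ℂ V] (hV : Module.finrank ℂ V = N + 1)
    (ρ : AW h A₁ A₂ A₃ →ₐ[ℂ] Module.End ℂ V) (hirr : IsIrreducible ρ) (hcl : IsClassical ρ) :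
    ∃ μ j₁ j₂ j₃ : ℂ, Admissible h N μ j₁ j₂ j₃ ∧ (A₁, A₂) ∈ parPairs h μ j₁ j₂ j₃ ∧
      A₃ = parA₃ h μ j₁ j₂ j₃ ∧
      ∃ σ : AW h A₁ A₂ A₃ →ₐ[ℂ] Module.End ℂ (Fin (N + 1) → ℂ),
        IsModel N μ j₁ j₂ j₃ σ ∧ Equivalent ρ σ := by
  have hs := qpow_ne_zero h (1 / 2)
  have : FiniteDimensional ℂ V := Module.finite_of_finrank_pos (by omega)
  have : Nontrivial V := hirr.1
  have R := relations_of_rep ρ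
  have hirr' : ∀ U : Submodule ℂ V, (∀ x ∈ U, ρ (I₁ h A₁ A₂ A₃) x ∈ U ∧
      ρ (I₂ h A₁ A₂ A₃) x ∈ U ∧ ρ (I₃ h A₁ A₂ A₃) x ∈ U) → U = ⊥ ∨ U = ⊤ := fun U hU =>
    hirr.2 U (invariant_of_generators ρ U (fun x hx => (hU x hx).1) (fun x hx => (hU x hx).2.1)
      (fun x hx => (hU x hx).2.2))
  obtain ⟨t, v, d, n, ht, hn, C⟩ := R.exists_isChain hs G fun t ht => hcl.reg G ht
  obtain ⟨μ, rfl⟩ := G.qpow_surjective ht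
  have hli := C.linearIndependent hs ht G
  have himg : Set.range (fun j : Fin n => v j) = v '' Set.Ico 0 n := by
    ext x
    constructor
    · rintro ⟨j, rfl⟩
      exact ⟨j, ⟨Nat.zero_le _, j.2⟩, rfl⟩
    · rintro ⟨j, ⟨_, h2⟩, rfl⟩
      exact ⟨⟨j, h2⟩, rfl⟩
  -- With `d 0 = 0` the whole chain is an invariant tail; hence it is a basis and its length is the
  -- dimension.
  have hspan : ⊤ ≤ Submodule.span ℂ (Set.range (fun j : Fin n => v j)) := by
    rw [himg, C.span_eq_top hs hirr' C.zero hn]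
  obtain rfl : n = N + 1 := by
    rw [← hV, Module.finrank_eq_card_basis (Module.Basis.mk hli hspan), Fintype.card_fin]
  have hreg : ∀ j ≤ N, Reg (qpow h (1 / 2)) (qpow h (μ - (j : ℕ))) := fun j hj => by
    rw [qpow_sub_nat]
    exact C.reg j (by omega)
  have ha := (forall_reg_iff h μ N).1 hreg
  obtain ⟨j₁, j₂, j₃, M⟩ := G.exists_match μ A₁ A₂ A₃ (by simpa using hreg 0 (by omega))
  -- Both sequences start at 0 and have the same increments.
  have hDd : ∀ k ≤ N + 1, D h μ j₁ j₂ j₃ (k : ℕ) = d k := by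
    intro k
    induction k with
    | zero => intro _; rw [Nat.cast_zero, D_zero, C.zero]
    | succ k ih =>
      intro hk
      rw [G.D_succ M k (hreg k (by omega)), ih (by omega), C.succ, qpow_sub_nat]
  obtain ⟨hmem, hA₃⟩ := G.mem_of_match M
  refine ⟨μ, j₁, j₂, j₃, ⟨ha, ?_, ?_⟩, hmem, hA₃, ?_⟩
  · have := (G.D_eq_zero_iff ha (k := N + 1) (by omega) le_rfl).1
      ((hDd _ le_rfl).trans C.final)
    push_cast at this
    exact this
  · intro k h1 h2
    have hne := C.d_ne hs ht G hirr' h1 (by omega)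
    rw [← hDd k (by omega), Ne, G.D_eq_zero_iff ha h1 (by omega)] at hne
    tauto
  · obtain ⟨b, hb⟩ : ∃ b : Module.Basis (Fin (N + 1)) ℂ V, ∀ j : Fin (N + 1), b j = v j :=
      ⟨Module.Basis.mk hli hspan, fun j => by rw [Module.Basis.mk_apply]⟩
    let e : V ≃ₗ[ℂ] (Fin (N + 1) → ℂ) := b.equivFun
    have he : ∀ k ≤ N, e (v k) = vec N k := by
      intro k hk
      ext i
      rw [← hb ⟨k, by omega⟩]
      simp only [e, Module.Basis.equivFun_self]
      simp [vec, Fin.ext_iff, eq_comm]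
    have he' : ∀ k ≤ N, e.symm (vec N k) = v k := fun k hk => by
      rw [← he k hk, e.symm_apply_apply]
    have hsucc : ∀ k ≤ N, e (v (k + 1)) = vec N (k + 1) := by
      intro k hk
      rcases Nat.lt_or_ge k N with h1 | h1
      · exact he _ h1
      · obtain rfl : k = N := by omega
        rw [C.last, map_zero, vec_eq_zero (by omega)]
    -- `σ` is `ρ` transported to coordinates in the chain basis, so equivalence is automatic and
    -- only the matrices of the generators must be compared.
    refine ⟨((LinearEquiv.conjAlgEquiv ℂ e).toAlgHom).comp ρ, ⟨?_, ?_, ?_⟩, e, fun a x => ?_⟩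
    · refine linearMap_ext_vec fun k hk => ?_
      have : e (ρ (I₁ h A₁ A₂ A₃) (e.symm (vec N k))) =
          Matrix.toLin' (M₁ h N A₁ A₂ μ j₁ j₂ j₃) (vec N k) := by
        rw [he' k hk, C.X_apply hs (by omega), ← qpow_sub_nat, ← hDd k (by omega), map_sub,
          map_smul, map_smul, map_add, map_smul, he k hk, he (k - 1) (by omega), hsucc k hk,
          ← M₁_vec G hk]
      exact this
    · refine linearMap_ext_vec fun k hk => ?_
      have : e (ρ (I₂ h A₁ A₂ A₃) (e.symm (vec N k))) =
          Matrix.toLin' (M₂ h N A₁ A₂ μ j₁ j₂ j₃) (vec N k) := by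
        rw [he' k hk, C.Y_apply (by omega), ← qpow_sub_nat, ← hDd k (by omega), map_sub,
          map_smul, map_smul, map_sub, map_smul, map_smul, map_smul, he k hk,
          he (k - 1) (by omega), hsucc k hk, ← M₂_vec G hk]
      exact this
    · refine linearMap_ext_vec fun k hk => ?_
      have : e (ρ (I₃ h A₁ A₂ A₃) (e.symm (vec N k))) =
          Matrix.toLin' (M₃ h N μ) (vec N k) := by
        rw [he' k hk, C.eigen k (by omega), ← qpow_sub_nat, map_smul, he k hk, ← M₃_vec]
      exact this
    · change _ = e (ρ a (e.symm (e x)))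
      rw [e.symm_apply_apply]

end Main

end

end AskeyWilson

theorem theorem3 (q h : ℂ) (hh : Complex.exp h = q) (hq : ∀ n : ℕ, 0 < n → q ^ n ≠ 1) (N : ℕ) :
    (∀ (A₁ A₂ A₃ : ℂ) (V : Type*) [AddCommGroup V] [Module ℂ V],
      Module.finrank ℂ V = N + 1 →
      ∀ ρ : AskeyWilson.AW h A₁ A₂ A₃ →ₐ[ℂ] Module.End ℂ V, AskeyWilson.IsIrreducible ρ → AskeyWilson.IsClassical ρ →
        ∃ μ j₁ j₂ j₃ : ℂ,
          AskeyWilson.Admissible h N μ j₁ j₂ j₃ ∧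
          (A₁, A₂) ∈ AskeyWilson.parPairs h μ j₁ j₂ j₃ ∧
          A₃ = AskeyWilson.parA₃ h μ j₁ j₂ j₃ ∧
          ∃ σ : AskeyWilson.AW h A₁ A₂ A₃ →ₐ[ℂ] Module.End ℂ (Fin (N + 1) → ℂ),
            AskeyWilson.IsModel N μ j₁ j₂ j₃ σ ∧ AskeyWilson.Equivalent ρ σ) ∧
    (∀ μ j₁ j₂ j₃ : ℂ, AskeyWilson.Admissible h N μ j₁ j₂ j₃ →
      ∀ B₁ B₂ : ℂ, (B₁, B₂) ∈ AskeyWilson.parPairs h μ j₁ j₂ j₃ →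
        ∃ σ : AskeyWilson.AW h B₁ B₂ (AskeyWilson.parA₃ h μ j₁ j₂ j₃) →ₐ[ℂ] Module.End ℂ (Fin (N + 1) → ℂ),
          AskeyWilson.IsModel N μ j₁ j₂ j₃ σ ∧ AskeyWilson.IsIrreducible σ) := by
  have G : AskeyWilson.Generic h := fun n hn => by
    have e : AskeyWilson.qpow h (1 / 2) ^ 2 = q := by
      rw [← AskeyWilson.qpow_one, AskeyWilson.qpow, one_mul, hh]
    rw [e]
    exact hq n hn
  exact ⟨fun _ _ _ _ _ _ hV ρ hirr hcl => G.exists_equivalent hV ρ hirr hcl,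
    fun _ _ _ _ hadm _ _ hB => G.exists_model hadm hB⟩
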